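/- **Setting.** Let $1<R_E$ and $R>R_E+1$, put $W=\frac{2R}{\sqrt{R_E^2-1}}$, $\Omega=B(0,1)\subset\mathbb R^2$ and $\Omega'={]-\frac W2,\frac W2[}\times S^1$, where $S^1$ is identified with $[-\pi,\pi[$. Functions on $\Omega$ and $\Omega'$ are extended by zero to $\mathbb R^2$ and $\mathbb R\times S^1$. Write $\vartheta(\alpha)=(\cos\alpha,\sin\alpha)$ and $\vartheta(\alpha)^\perp=(-\sin\alpha,\cos\alpha)$, and for $x\in\mathbb R^2$ $$d(x,\alpha)=x\cdot\vartheta(\alpha)^\perp+R_E,\qquad \Xi(x,\alpha)=\frac{R\,x\cdot\vartheta(\alpha)}{d(x,\alpha)} .$$ The fanbeam transform of $f\in L^2(\Omega)$ and its adjoint applied to $g\in L^2(\Omega')$ are $$[\mathcal F f](\xi,\alpha)=\sqrt{\xi^2+R^2}\int_{\mathbb R} f\bigl(t(\xi\vartheta(\alpha)+R\vartheta(\alpha)^\perp)-R_E\vartheta(\alpha)^\perp\bigr)\,dt,$$ $$[\mathcal F^* g](x)=\int_{[-\pi,\pi[}\sqrt{\Xi(x,\alpha)^2+R^2}\;\frac{1}{d(x,\alpha)}\;g\bigl(\Xi(x,\alpha),\alpha\bigr)\,d\alpha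 .$$ The $L^2$ modulus of continuity of $g\in L^2(\mathbb R\times S^1)$ is $\omega_g(h,\gamma)=\bigl(\int_{S^1}\int_{\mathbb R}|g(s+h,\alpha+\gamma)-g(s,\alpha)|^2\,ds\,d\alpha\bigr)^{1/2}$. **Discretization.** A discretization consists of integers $P,Q\ge 1$, $N,M\geq 0$, angles $-\pi\le\alpha_1<\dots<\alpha_Q<\pi$ and a pixel size $\delta_x>0$. Put $\alpha_0=\alpha_Q-2\pi$, $\alpha_{Q+1}=\alpha_1+2\pi$, and $$\delta_\xi=\tfrac WP,\quad \xi_p=\delta_\xi\bigl(p-\tfrac{P+1}2\bigr),\quad \Xi_p=\xi_p+[-\tfrac{\delta_\xi}2,\tfrac{\delta_\xi}2[,\quad \delta_\alpha=\max_{1\le q\le Q}(\alpha_{q+1}-\alpha_q),$$ $$\Phi_q=\bigl[\tfrac{\alpha_{q-1}+\alpha_q}2,\tfrac{\alpha_q+\alpha_{q+1}}2\bigr[\ (\mathrm{mod}\ 2\pi),\quad \Delta_q=\tfrac{\alpha_{q+1}-\alpha_{q-1}}2,$$ $$x_{ij}=\delta_x\bigl(i-\tfrac{N+1}2,\,j-\tfrac{M+1}2\bigr),\quad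 X_{ij}=x_{ij}+[-\tfrac{\delta_x}2,\tfrac{\delta_x}2[^2\qquad(1\le i\le N,\ 1\le j\le M),$$ and assume $\Omega\subset\bigcup_{i,j}X_{ij}$. With $w_\delta(t)=\max(0,\delta-|t|)$, $f_{ij}=\frac1{\delta_x^2}\int_{X_{ij}}f$ and $g_{pq}=\frac1{\delta_\xi\Delta_q}\int_{\Xi_p}\int_{\Phi_q}g(\xi,\alpha)\,d\alpha\,d\xi$, the discrete fanbeam transform and its adjoint are $$[\mathcal F^{\delta_x}_{\delta_\xi,\delta_\alpha}f](\xi,\alpha)=\frac{\delta_x^2}{\delta_\xi^2}\sum_{p=1}^P\sum_{q=1}^Q\chi_{\Xi_p}(\xi)\chi_{\Phi_q}(\alpha)\sqrt{\xi_p^2+R^2}\sum_{i,j=1}^{N,M}w_{\delta_\xi}\bigl(\Xi(x_{ij},\alpha_q)-\xi_p\bigr)\frac{f_{ij}}{d(x_{ij},\alpha_q)},$$ $$[(\mathcal F^{\delta_x}_{\delta_\xi,\delta_\alpha})^*g](x)=\sum_{i,j=1}^{N,M}\chi_{X_{ij}}(x)\sum_{q=1}^Q\frac{\Delta_q}{\delta_\xi}\sum_{p=1}^Pw_{\delta_\xi}\bigl(\Xi(x_{ij},\alpha_q)-\xi_p\bigr)\frac{\sqrt{\xi_p^2+R^2}}{d(x_{ij},\alpha_q)}\,g_{pq}$$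 (terms with $d(x_{ij},\alpha_q)=0$, which can only occur on coarse grids, are read as $0$). **Theorem.** Let $f\in L^2(\Omega)$, $g\in L^2(\Omega')$, $0<\epsilon\le 1$ and $c\ge 0$. Consider a family of such discretizations along which $\delta_\xi\to0$, $\delta_x=\mathcal O(\delta_\xi^{1+\epsilon})$ and $\delta_\alpha=\mathcal O(\delta_\xi^{1+\epsilon})$. Suppose that eventually along this family $$\int_{|t|\le\delta_\xi}\omega_{\mathcal F f}(t,0)^2\,dt\le c\,\delta_\xi^{1+2\epsilon}\|f\|_{L^2(\Omega)}^2\qquad\text{and}\qquad\int_{|t|\le\delta_\xi}\omega_g(t,0)^2\,dt\le c\,\delta_\xi^{1+2\epsilon}\|g\|_{L^2(\Omega')}^2 .$$ Then $\mathcal F f\in L^2(\Omega')$, $\mathcal F^*g\in L^2(\Omega)$, and $$\|\mathcal F^{\delta_x}_{\delta_\xi,\delta_\alpha}f-\mathcal F f\|_{L^2(\Omega')}=\mathcal O(\delta_\xi^\epsilon)\qquad\text{and}\qquad\|(\mathcal F^{\delta_x}_{\delta_\xi,\delta_\alpha})^*g-\mathcal F^*g\|_{L^2(\Omega)}=\mathcal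 O(\delta_\xi^\epsilon).$$ -/

import Mathlib

open MeasureTheory Filter Topology Set Asymptotics
open scoped ENNReal

noncomputable section

namespace Fanbeam

/-- The image plane `ℝ²` with its Euclidean structure. -/
abbrev Plane : Type := EuclideanSpace ℝ (Fin 2)

/-- The image domain: the open unit ball. -/
def imageDomain : Set Plane := Metric.ball 0 1

/-- `ϑ(α) = (cos α, sin α)`. -/
def dir (α : ℝ) : Plane := !₂[Real.cos α, Real.sin α]

/-- `ϑ(α)^⊥ = (-sin α, cos α)`. -/
def dirPerp (α : ℝ) : Plane := !₂[-Real.sin α, Real.cos α]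

/-- The interval `[-π, π)`, which parametrizes the circle. -/
def circle : Set ℝ := Ico (-Real.pi) Real.pi

/-- The total width `W = 2 R / √(R_E² - 1)` of the detector. -/
def detectorWidth (R RE : ℝ) : ℝ := 2 * (R / √(RE ^ 2 - 1))

/-- The sinogram domain `(-W/2, W/2) × S¹`. -/
def sinogramDomain (R RE : ℝ) : Set (ℝ × ℝ) :=
  Ioo (-(detectorWidth R RE / 2)) (detectorWidth R RE / 2) ×ˢ circle

/-- The `L²` modulus of continuity
`(∫_{S¹} ∫_ℝ |g(s + h, α + γ) - g(s, α)|² ds dα)^{1/2}` of a function `g` on `ℝ × [-π, π)`,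
where `α + γ` is reduced modulo `2π` to `[-π, π)`. -/
def modulus (g : ℝ × ℝ → ℝ) (h γ : ℝ) : ℝ≥0∞ :=
  eLpNorm
    (fun z : ℝ × ℝ => g (z.1 + h, toIcoMod Real.two_pi_pos (-Real.pi) (z.2 + γ)) - g z)
    2 (volume.restrict (univ ×ˢ circle))

/-- The fanbeam transform
`[F f](ξ, α) = √(ξ² + R²) ∫_ℝ f(t (ξ ϑ(α) + R ϑ(α)^⊥) - R_E ϑ(α)^⊥) dt`. -/
def transform (R RE : ℝ) (f : Plane → ℝ) (z : ℝ × ℝ) : ℝ :=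
  √(z.1 ^ 2 + R ^ 2) *
    ∫ t : ℝ, f (t • (z.1 • dir z.2 + R • dirPerp z.2) - RE • dirPerp z.2)

/-- The distance `x · ϑ(α)^⊥ + R_E` from the source to `x`, projected to the central ray. -/
def depth (RE : ℝ) (x : Plane) (α : ℝ) : ℝ := inner ℝ x (dirPerp α) + RE

/-- The detector offset `(x · ϑ(α)) R / (x · ϑ(α)^⊥ + R_E)` of the ray through `x`. -/
def offset (R RE : ℝ) (x : Plane) (α : ℝ) : ℝ := inner ℝ x (dir α) * R / depth RE x α

/-- The adjoint `F^*` of the fanbeam transform (fanbeam backprojection). -/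
def transformAdjoint (R RE : ℝ) (g : ℝ × ℝ → ℝ) (x : Plane) : ℝ :=
  ∫ α in circle,
    √(offset R RE x α ^ 2 + R ^ 2) * (1 / depth RE x α) * g (offset R RE x α, α)

/-- The parameters of a discretization: `P` detector pixels, `Q` angles
`-π ≤ α_1 < ... < α_Q < π` (only the values `angle 1, ..., angle Q` matter), and an
`N × M` grid of square image pixels of side length `δ_x = pixelSize`. -/
structure Grid where
  P : ℕ
  Q : ℕ
  N : ℕ
  M : ℕ
  angle : ℕ → ℝ
  pixelSize : ℝ
  one_le_P : 1 ≤ P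
  one_le_Q : 1 ≤ Q
  angle_mem : ∀ q ∈ Finset.Icc 1 Q, angle q ∈ circle
  angle_strictMono : StrictMonoOn angle (Icc 1 Q)
  pixelSize_pos : 0 < pixelSize

namespace Grid

variable (D : Grid) (R RE : ℝ)

/-- The detector pixel size `δ_ξ = W / P`. -/
def detectorSize : ℝ := detectorWidth R RE / D.P

/-- The detector offsets `ξ_p = (W / P) (p - (P + 1) / 2)`, `p = 1, ..., P`. -/
def detectorOffset (p : ℕ) : ℝ := D.detectorSize R RE * ((p : ℝ) - ((D.P : ℝ) + 1) / 2)

/-- The detector pixel `Ξ_p = ξ_p + [-δ_ξ/2, δ_ξ/2)`. -/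
def detectorPixel (p : ℕ) : Set ℝ :=
  Ico (D.detectorOffset R RE p - D.detectorSize R RE / 2)
    (D.detectorOffset R RE p + D.detectorSize R RE / 2)

/-- The angles, continued by `α_0 = α_Q - 2π` and `α_{Q+1} = α_1 + 2π`. -/
def angleExt (q : ℕ) : ℝ :=
  if q = 0 then D.angle D.Q - 2 * Real.pi
  else if q = D.Q + 1 then D.angle 1 + 2 * Real.pi
  else D.angle q

/-- The angular cell `Φ_q = [(α_{q-1} + α_q)/2, (α_q + α_{q+1})/2)` modulo `2π`, as a subset of
`[-π, π)`; used for `1 ≤ q ≤ Q`. -/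
def angleCell (q : ℕ) : Set ℝ :=
  {α | α ∈ circle ∧ ∃ k : ℤ, α + 2 * Real.pi * k ∈
    Ico ((D.angleExt (q - 1) + D.angleExt q) / 2) ((D.angleExt q + D.angleExt (q + 1)) / 2)}

/-- The length `Δ_q = (α_{q+1} - α_{q-1})/2` of `Φ_q`; used for `1 ≤ q ≤ Q`. -/
def angleLength (q : ℕ) : ℝ := (D.angleExt (q + 1) - D.angleExt (q - 1)) / 2

/-- The angular discretization width `δ_α = max_{1 ≤ q ≤ Q} (α_{q+1} - α_q)`. -/
def angleWidth : ℝ :=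
  (Finset.Icc 1 D.Q).sup' (Finset.nonempty_Icc.mpr D.one_le_Q)
    fun q => D.angleExt (q + 1) - D.angleExt q

/-- The image pixel centers `x_{ij} = δ_x (i - (N + 1)/2, j - (M + 1)/2)`. -/
def pixelCenter (i j : ℕ) : Plane :=
  !₂[D.pixelSize * ((i : ℝ) - ((D.N : ℝ) + 1) / 2), D.pixelSize * ((j : ℝ) - ((D.M : ℝ) + 1) / 2)]

/-- The image pixels `X_{ij} = x_{ij} + [-δ_x/2, δ_x/2)²`. -/
def pixel (i j : ℕ) : Set Plane :=
  {x | ∀ k, x k ∈ Ico (D.pixelCenter i j k - D.pixelSize / 2)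
    (D.pixelCenter i j k + D.pixelSize / 2)}

/-- Compatibility with the image domain: the unit ball is covered by the image pixels. -/
def Covers : Prop :=
  imageDomain ⊆ ⋃ i ∈ Finset.Icc 1 D.N, ⋃ j ∈ Finset.Icc 1 D.M, D.pixel i j

/-- The mean value `f_{ij} = δ_x^{-2} ∫_{X_{ij}} f`. -/
def imageMean (f : Plane → ℝ) (i j : ℕ) : ℝ :=
  1 / D.pixelSize ^ 2 * ∫ x in D.pixel i j, f x

/-- The mean value `g_{pq} = (δ_ξ Δ_q)^{-1} ∫_{Ξ_p} ∫_{Φ_q} g`. -/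
def sinogramMean (g : ℝ × ℝ → ℝ) (p q : ℕ) : ℝ :=
  1 / (D.detectorSize R RE * D.angleLength q) *
    ∫ z in D.detectorPixel R RE p ×ˢ D.angleCell q, g z

/-- The hat function `w_δ(t) = max(0, δ - |t|)`. -/
def hat (δ t : ℝ) : ℝ := max 0 (δ - |t|)

/-- The pixel-driven discrete fanbeam transform. -/
def discreteTransform (f : Plane → ℝ) (z : ℝ × ℝ) : ℝ :=
  D.pixelSize ^ 2 / D.detectorSize R RE ^ 2 *
    ∑ p ∈ Finset.Icc 1 D.P, ∑ q ∈ Finset.Icc 1 D.Q,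
      (D.detectorPixel R RE p).indicator 1 z.1 * (D.angleCell q).indicator 1 z.2 *
        √(D.detectorOffset R RE p ^ 2 + R ^ 2) *
        ∑ i ∈ Finset.Icc 1 D.N, ∑ j ∈ Finset.Icc 1 D.M,
          hat (D.detectorSize R RE)
              (offset R RE (D.pixelCenter i j) (D.angle q) - D.detectorOffset R RE p) *
            (D.imageMean f i j / depth RE (D.pixelCenter i j) (D.angle q))

/-- The adjoint of the discrete fanbeam transform (pixel-driven backprojection). -/
def discreteTransformAdjoint (g : ℝ × ℝ → ℝ) (x : Plane) : ℝ :=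
  ∑ i ∈ Finset.Icc 1 D.N, ∑ j ∈ Finset.Icc 1 D.M,
    (D.pixel i j).indicator 1 x *
      ∑ q ∈ Finset.Icc 1 D.Q, D.angleLength q / D.detectorSize R RE *
        ∑ p ∈ Finset.Icc 1 D.P,
          hat (D.detectorSize R RE)
              (offset R RE (D.pixelCenter i j) (D.angle q) - D.detectorOffset R RE p) *
            (√(D.detectorOffset R RE p ^ 2 + R ^ 2) /
              depth RE (D.pixelCenter i j) (D.angle q)) *
            D.sinogramMean R RE g p q

end Grid

end Fanbeam

end

/-! ### Fanbeam coordinates and the change of variables -/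

namespace Fanbeam

/-! Fix α and describe x by the detector position ξ of its ray and the parameter t on it. Then Ξ(x,
α) = ξ, d(x, α) = tR and dx = |tR| dξ dt (`lintegral_plane_eq`), so on the disc the Jacobian cancels
the factor 1/d. Integrating f against w_δ(Ξ(x, α) - c)/d(x, α) over the plane is therefore the same
as integrating the ray integrals of f against w_δ(ξ - c) (`integrable_hat_mul_ray`). The hat
function has mass δ², so after division by δ² this is an average of ray integrals at scale δ = δ_ξ.
The discrete operators are integral operators with the same kernel, except that x, α and ξ are
replaced by the centers of their cells (`exists_discreteTransform_eq`,
`exists_discreteTransformAdjoint_eq`). Since they use exact cell means, no regularity of f or g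
within the cells is needed for this.

Two errors remain. Moving x and α by at most η = O(δ^(1+ε)) changes the kernel by O(η), and only on
a strip |Ξ - ξ| ≤ r with r = O(δ). With the factor δ⁻² this is a window integral of size η/δ² over a
window of length O(δ), of L² norm O(η/δ) = O(δ^ε). Averaging in ξ costs differences over shifts up
to 2δ, which the modulus hypothesis controls, and freezing the weight √(ξ² + R²) costs O(δ), which
is O(δ^ε) as ε ≤ 1. Both errors are dominated by `majorant`, whose L² norm is estimated by
Cauchy–Schwarz and translation invariance (`lintegral_majorant_sq_le`).

For the adjoint, the hats at the cell centers form a partition of unity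
(`integral_hat_sub_cellCenter`), so F^* g(x) too becomes a double integral over the cylinder that
can be compared with the discrete one. The error at x is then at most the integral over α of a
majorant at (Ξ(x, α), α), and backprojection is bounded on L² (`lintegral_sq_backprojection_le`).

These estimates are made for Borel functions; the general case follows because all quantities are
insensitive to null sets. -/

lemma orthonormal_dir (α : ℝ) : Orthonormal ℝ ![dir α, dirPerp α] := by
  rw [orthonormal_iff_ite]
  intro i j
  have h := Real.sin_sq_add_cos_sq α
  fin_cases i <;> fin_cases j <;>
    simp [dir, dirPerp, PiLp.inner_apply, Fin.sum_univ_two, EuclideanSpace.norm_eq] <;>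
    ring

/-- The orthonormal basis `(ϑ(α), ϑ(α)^⊥)` of the plane. -/
noncomputable def dirBasis (α : ℝ) : OrthonormalBasis (Fin 2) ℝ Plane :=
  (basisOfOrthonormalOfCardEqFinrank (orthonormal_dir α) (by simp)).toOrthonormalBasis
    (by simpa using orthonormal_dir α)

lemma measurePreserving_dirBasis (α : ℝ) :
    MeasurePreserving (fun p : ℝ × ℝ => p.1 • dir α + p.2 • dirPerp α) volume volume := by
  have h1 := (dirBasis α).measurePreserving_repr_symm
  have h2 := (EuclideanSpace.volume_preserving_symm_measurableEquiv_toLp (Fin 2)).symm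
  have h3 := (volume_preserving_finTwoArrow ℝ).symm
  have h := h1.comp (h2.comp h3)
  convert h using 1
  ext1 p
  simp only [Function.comp]
  rw [← OrthonormalBasis.sum_repr_symm]
  simp [dirBasis, Fin.sum_univ_two, MeasurableEquiv.finTwoArrow]

/-- The point with parameter `t` on the ray from the source to the detector position `z`. -/
noncomputable def rayPoint (R RE : ℝ) (z : ℝ × ℝ) (t : ℝ) : Plane :=
  t • (z.1 • dir z.2 + R • dirPerp z.2) - RE • dirPerp z.2

lemma rayPoint_eq (R RE : ℝ) (z : ℝ × ℝ) (t : ℝ) :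
    rayPoint R RE z t = (t * z.1) • dir z.2 + (t * R - RE) • dirPerp z.2 := by
  simp only [rayPoint]; module

@[fun_prop]
lemma continuous_dir : Continuous dir := by
  unfold dir
  refine (PiLp.continuous_toLp 2 _).comp (continuous_pi fun i => ?_)
  fin_cases i <;> simp <;> fun_prop

@[fun_prop]
lemma continuous_dirPerp : Continuous dirPerp := by
  unfold dirPerp
  refine (PiLp.continuous_toLp 2 _).comp (continuous_pi fun i => ?_)
  fin_cases i <;> simp <;> fun_prop

@[fun_prop]
lemma continuous_rayPoint (R RE : ℝ) :
    Continuous fun p : (ℝ × ℝ) × ℝ => rayPoint R RE p.1 p.2 := by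
  unfold rayPoint
  fun_prop

lemma inner_rayPoint_dir (R RE : ℝ) (z : ℝ × ℝ) (t : ℝ) :
    inner ℝ (rayPoint R RE z t) (dir z.2) = t * z.1 := by
  rw [rayPoint_eq]
  have h := Real.sin_sq_add_cos_sq z.2
  simp only [dir, dirPerp, PiLp.inner_apply, Fin.sum_univ_two]
  simp
  linear_combination (t * z.1) * h

lemma depth_rayPoint (R RE : ℝ) (z : ℝ × ℝ) (t : ℝ) :
    depth RE (rayPoint R RE z t) z.2 = t * R := by
  rw [depth, rayPoint_eq]
  have h := Real.sin_sq_add_cos_sq z.2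
  simp only [dir, dirPerp, PiLp.inner_apply, Fin.sum_univ_two]
  simp
  linear_combination (t * R - RE) * h

lemma offset_rayPoint {R : ℝ} (hR : R ≠ 0) (RE : ℝ) (z : ℝ × ℝ) {t : ℝ} (ht : t ≠ 0) :
    offset R RE (rayPoint R RE z t) z.2 = z.1 := by
  rw [offset, inner_rayPoint_dir, depth_rayPoint]
  field_simp

lemma norm_dir (α : ℝ) : ‖dir α‖ = 1 := (orthonormal_dir α).1 0

lemma norm_dirPerp (α : ℝ) : ‖dirPerp α‖ = 1 := (orthonormal_dir α).1 1

lemma abs_inner_dir_le (x : Plane) (α : ℝ) : |inner ℝ x (dir α)| ≤ ‖x‖ := by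
  simpa [norm_dir] using abs_real_inner_le_norm x (dir α)

lemma abs_inner_dirPerp_le (x : Plane) (α : ℝ) : |inner ℝ x (dirPerp α)| ≤ ‖x‖ := by
  simpa [norm_dirPerp] using abs_real_inner_le_norm x (dirPerp α)

lemma lintegral_comp_mul_left {a : ℝ} (ha : a ≠ 0) {h : ℝ → ℝ≥0∞} (hh : Measurable h) :
    ∫⁻ x, h x = ENNReal.ofReal |a| * ∫⁻ x, h (a * x) := by
  conv_lhs => rw [← Real.smul_map_volume_mul_left ha]
  rw [lintegral_smul_measure, lintegral_map hh (by fun_prop), smul_eq_mul]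

/-- Integration over the plane in fanbeam coordinates. -/
lemma lintegral_plane_eq {R : ℝ} (hR : R ≠ 0) (RE α : ℝ) {h : Plane → ℝ≥0∞} (hh : Measurable h) :
    ∫⁻ x, h x =
      ∫⁻ p : ℝ × ℝ, ENNReal.ofReal |p.2 * R| * h (rayPoint R RE (p.1, α) p.2) := by
  have hc : Measurable fun p : ℝ × ℝ => p.1 • dir α + p.2 • dirPerp α := by fun_prop
  have hc' : Measurable fun p : ℝ × ℝ => rayPoint R RE (p.1, α) p.2 :=
    ((continuous_rayPoint R RE).comp
      (by fun_prop : Continuous fun p : ℝ × ℝ => ((p.1, α), p.2))).measurable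
  -- With (u, v) the coordinates in the orthonormal frame, substitute v = tR, shift t by RE/R to get
  -- v = tR - RE, and for fixed t ≠ 0 substitute u = tξ. The factors |R| and |t| form the Jacobian.
  rw [← (measurePreserving_dirBasis α).lintegral_comp hh, Measure.volume_eq_prod,
    lintegral_prod_symm _ (by fun_prop), lintegral_prod_symm _ (by fun_prop),
    lintegral_comp_mul_left hR (by fun_prop), ← lintegral_sub_right_eq_self _ (RE / R),
    ← lintegral_const_mul _ (by fun_prop)]
  refine lintegral_congr_ae ?_
  have h0 : ∀ᵐ t : ℝ, t ≠ 0 := by simp [ae_iff]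
  filter_upwards [h0] with t ht
  rw [lintegral_comp_mul_left ht (by fun_prop), ← mul_assoc, ← ENNReal.ofReal_mul (abs_nonneg _),
    ← abs_mul, mul_comm R t, ← lintegral_const_mul _ (by fun_prop)]
  refine lintegral_congr fun u => ?_
  rw [rayPoint_eq]
  congr 4
  field_simp

/-- The change of variables as an identity of measures, which transfers it to integrability and to
Bochner integrals. -/
lemma map_rayPoint {R : ℝ} (hR : R ≠ 0) (RE α : ℝ) :
    Measure.map (fun p : ℝ × ℝ => rayPoint R RE (p.1, α) p.2)
      ((volume : Measure (ℝ × ℝ)).withDensity fun p => ENNReal.ofReal |p.2 * R|) = volume := by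
  have hc' : Measurable fun p : ℝ × ℝ => rayPoint R RE (p.1, α) p.2 :=
    ((continuous_rayPoint R RE).comp
      (by fun_prop : Continuous fun p : ℝ × ℝ => ((p.1, α), p.2))).measurable
  refine Measure.ext_of_lintegral _ fun h hh => ?_
  rw [lintegral_map hh hc', lintegral_withDensity_eq_lintegral_mul _ (by fun_prop) (by fun_prop),
    lintegral_plane_eq hR RE α hh]
  rfl

lemma integrable_rayPoint {R : ℝ} (hR : R ≠ 0) (RE α : ℝ) {h : Plane → ℝ} (hh : Integrable h) :
    Integrable fun p : ℝ × ℝ => |p.2 * R| * h (rayPoint R RE (p.1, α) p.2) := by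
  have hc' : Measurable fun p : ℝ × ℝ => rayPoint R RE (p.1, α) p.2 :=
    ((continuous_rayPoint R RE).comp
      (by fun_prop : Continuous fun p : ℝ × ℝ => ((p.1, α), p.2))).measurable
  rw [← map_rayPoint hR RE α] at hh
  have hi := hh.comp_measurable hc'
  rw [integrable_withDensity_iff_integrable_smul' (by fun_prop)
      (ae_of_all _ fun _ => ENNReal.ofReal_lt_top)] at hi
  simpa using hi

lemma integral_plane_eq {R : ℝ} (hR : R ≠ 0) (RE α : ℝ) {h : Plane → ℝ}
    (hh : Integrable h) :
    ∫ x, h x = ∫ p : ℝ × ℝ, |p.2 * R| * h (rayPoint R RE (p.1, α) p.2) := by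
  have hc' : Measurable fun p : ℝ × ℝ => rayPoint R RE (p.1, α) p.2 :=
    ((continuous_rayPoint R RE).comp
      (by fun_prop : Continuous fun p : ℝ × ℝ => ((p.1, α), p.2))).measurable
  have hm := map_rayPoint hR RE α
  rw [← hm] at hh
  conv_lhs => rw [← hm]
  rw [integral_map hc'.aemeasurable hh.aestronglyMeasurable,
    integral_withDensity_eq_integral_toReal_smul (by fun_prop)
      (ae_of_all _ fun _ => ENNReal.ofReal_lt_top)]
  simp

/-! ### Square estimates for window integrals and moduli of continuity on the cylinder -/

lemma sq_add_le (a b : ℝ≥0∞) : (a + b) ^ 2 ≤ 4 * (a ^ 2 + b ^ 2) := by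
  rcases le_total a b with h | h
  · calc (a + b) ^ 2 ≤ (b + b) ^ 2 := by gcongr
      _ = 4 * b ^ 2 := by ring
      _ ≤ _ := by gcongr; exact le_add_self
  · calc (a + b) ^ 2 ≤ (a + a) ^ 2 := by gcongr
      _ = 4 * a ^ 2 := by ring
      _ ≤ _ := by gcongr; exact le_self_add

lemma sq_lintegral_le {X : Type*} [MeasurableSpace X] (μ : Measure X) {H : X → ℝ≥0∞}
    (hH : AEMeasurable H μ) : (∫⁻ x, H x ∂μ) ^ 2 ≤ μ univ * ∫⁻ x, H x ^ 2 ∂μ := by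
  have h := ENNReal.lintegral_mul_le_Lp_mul_Lq μ (p := 2) (q := 2)
    (by constructor <;> norm_num) (f := fun _ => 1) (g := H) aemeasurable_const hH
  simp only [Pi.mul_apply, one_mul, ENNReal.one_rpow, lintegral_const] at h
  calc (∫⁻ x, H x ∂μ) ^ 2
      ≤ (μ univ ^ (1 / (2 : ℝ)) * (∫⁻ x, H x ^ (2 : ℝ) ∂μ) ^ (1 / (2 : ℝ))) ^ 2 := by gcongr
    _ = _ := by
      rw [mul_pow, ← ENNReal.rpow_natCast, ← ENNReal.rpow_natCast, ← ENNReal.rpow_mul,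
        ← ENNReal.rpow_mul]
      norm_num

/-- Lebesgue measure on the cylinder `ℝ × [-π, π)`. -/
noncomputable def cylinder : Measure (ℝ × ℝ) := volume.prod (volume.restrict circle)

instance : SFinite cylinder := by unfold cylinder; infer_instance

lemma cylinder_eq : cylinder = volume.restrict (univ ×ˢ circle) := by
  rw [cylinder, Measure.volume_eq_prod, ← Measure.prod_restrict, Measure.restrict_univ]

lemma measurableSet_circle : MeasurableSet circle := measurableSet_Ico

lemma volume_circle : volume circle = ENNReal.ofReal (2 * Real.pi) := by
  rw [circle, Real.volume_Ico]; congr 1; ring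

lemma lintegral_cylinder {H : ℝ × ℝ → ℝ≥0∞} (hH : Measurable H) :
    ∫⁻ z, H z ∂cylinder = ∫⁻ α in circle, ∫⁻ ξ, H (ξ, α) :=
  lintegral_prod_symm _ hH.aemeasurable

lemma lintegral_cylinder_shift {H : ℝ × ℝ → ℝ≥0∞} (hH : Measurable H) (s : ℝ) :
    ∫⁻ z, H (z.1 + s, z.2) ∂cylinder = ∫⁻ z, H z ∂cylinder := by
  rw [lintegral_cylinder hH, lintegral_cylinder (by fun_prop)]
  exact lintegral_congr fun α => lintegral_add_right_eq_self (fun ξ => H (ξ, α)) s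

lemma measurePreserving_cylinder_shift (s : ℝ) :
    MeasurePreserving (fun z : ℝ × ℝ => (z.1 + s, z.2)) cylinder cylinder := by
  refine ⟨by fun_prop, Measure.ext_of_lintegral _ fun h hh => ?_⟩
  rw [lintegral_map hh (by fun_prop), lintegral_cylinder_shift hh]

/-- Cauchy–Schwarz in s over a window of length 2r, then Tonelli. -/
lemma lintegral_sq_lintegral_Icc_le {r : ℝ} {K : (ℝ × ℝ) × ℝ → ℝ≥0∞} (hK : Measurable K) :
    ∫⁻ z, (∫⁻ s in Icc (-r) r, K (z, s)) ^ 2 ∂cylinder ≤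
      ENNReal.ofReal (2 * r) * ∫⁻ s in Icc (-r) r, ∫⁻ z, K (z, s) ^ 2 ∂cylinder := by
  calc ∫⁻ z, (∫⁻ s in Icc (-r) r, K (z, s)) ^ 2 ∂cylinder
      ≤ ∫⁻ z, (ENNReal.ofReal (2 * r) * ∫⁻ s in Icc (-r) r, K (z, s) ^ 2) ∂cylinder := by
        refine lintegral_mono fun z => (sq_lintegral_le _ (by fun_prop)).trans_eq ?_
        rw [Measure.restrict_apply_univ, Real.volume_Icc]
        congr 2; ring
    _ = _ := by
        rw [lintegral_const_mul _ (Measurable.lintegral_prod_right (by fun_prop)),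
          lintegral_lintegral_swap (by fun_prop)]

/-- Every shift s contributes the same amount by translation invariance, so the window length 2r
enters twice. -/
lemma lintegral_sq_average_le {r : ℝ} (hr : 0 ≤ r) {H : ℝ × ℝ → ℝ≥0∞} (hH : Measurable H) :
    ∫⁻ z, (∫⁻ s in Icc (-r) r, H (z.1 + s, z.2)) ^ 2 ∂cylinder ≤
      ENNReal.ofReal (4 * r ^ 2) * ∫⁻ z, H z ^ 2 ∂cylinder := by
  refine (lintegral_sq_lintegral_Icc_le
    (K := fun p => H (p.1.1 + p.2, p.1.2)) (by fun_prop)).trans_eq ?_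
  have h (s : ℝ) : ∫⁻ z, H (z.1 + s, z.2) ^ 2 ∂cylinder = ∫⁻ z, H z ^ 2 ∂cylinder :=
    lintegral_cylinder_shift (H := fun z => H z ^ 2) (by fun_prop) s
  rw [lintegral_congr h, lintegral_const, Measure.restrict_apply_univ, Real.volume_Icc]
  rw [mul_comm (∫⁻ z, H z ^ 2 ∂cylinder), ← mul_assoc, ← ENNReal.ofReal_mul (by positivity)]
  congr 2; ring

/-- The squared `L²` modulus of continuity in the detector variable. -/
noncomputable def modulusSq (g : ℝ × ℝ → ℝ) (s : ℝ) : ℝ≥0∞ :=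
  ∫⁻ z, ‖g (z.1 + s, z.2) - g z‖ₑ ^ 2 ∂cylinder

lemma eLpNorm_two_sq {X : Type*} [MeasurableSpace X] (μ : Measure X) (g : X → ℝ) :
    eLpNorm g 2 μ ^ 2 = ∫⁻ x, ‖g x‖ₑ ^ 2 ∂μ := by
  have := eLpNorm_nnreal_pow_eq_lintegral (f := g) (μ := μ) (p := 2) (by norm_num)
  simpa using this

lemma modulus_sq_eq (g : ℝ × ℝ → ℝ) (s : ℝ) : modulus g s 0 ^ 2 = modulusSq g s := by
  rw [modulus, eLpNorm_two_sq, modulusSq, cylinder_eq]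
  refine setLIntegral_congr_fun (MeasurableSet.univ.prod measurableSet_circle) fun z hz => ?_
  rw [(toIcoMod_eq_self Real.two_pi_pos).2]
  · simp
  · have := hz.2
    simp only [circle, mem_Ico] at this
    constructor <;> linarith [this.1, this.2]

lemma modulusSq_congr {g g' : ℝ × ℝ → ℝ} (h : g =ᵐ[cylinder] g') (s : ℝ) :
    modulusSq g s = modulusSq g' s := by
  refine lintegral_congr_ae ?_
  filter_upwards [h, (measurePreserving_cylinder_shift s).quasiMeasurePreserving.ae h]
    with z h1 h2
  rw [h1, h2]

lemma measurable_modulusSq {g : ℝ × ℝ → ℝ} (hg : Measurable g) : Measurable (modulusSq g) := by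
  unfold modulusSq
  exact Measurable.lintegral_prod_right'
    (f := fun p : ℝ × (ℝ × ℝ) => ‖g (p.2.1 + p.1, p.2.2) - g p.2‖ₑ ^ 2) (by fun_prop)

/-- A shift by 2s is two shifts by s, which have the same L² size; `sq_add_le` supplies the factor
4. -/
lemma modulusSq_two_mul_le {g : ℝ × ℝ → ℝ} (hg : Measurable g) (s : ℝ) :
    modulusSq g (2 * s) ≤ 8 * modulusSq g s := by
  let H : ℝ × ℝ → ℝ≥0∞ := fun z => ‖g (z.1 + s, z.2) - g z‖ₑ ^ 2
  have hH : Measurable H := by fun_prop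
  calc modulusSq g (2 * s) ≤ ∫⁻ z, 4 * (H (z.1 + s, z.2) + H z) ∂cylinder := by
        refine lintegral_mono fun z => le_trans ?_ (sq_add_le _ _)
        refine pow_le_pow_left' ?_ 2
        refine le_trans (le_of_eq ?_) (enorm_add_le _ _)
        congr 1
        simp only
        ring_nf
    _ = 8 * modulusSq g s := by
        rw [lintegral_const_mul _ (by fun_prop), lintegral_add_right _ hH,
          lintegral_cylinder_shift hH]
        simp only [modulusSq, H]
        ring

/-- The error estimates involve shifts up to 2δ, whereas the hypothesis of the theorem controls |t|
≤ δ only. The constant 16 is 2 from rescaling s times 8 from `modulusSq_two_mul_le`. -/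
lemma setLIntegral_modulusSq_two_mul_le {g : ℝ × ℝ → ℝ} (hg : Measurable g) (r : ℝ) :
    ∫⁻ s in Icc (-(2 * r)) (2 * r), modulusSq g s ≤
      16 * ∫⁻ s in Icc (-r) r, modulusSq g s := by
  have hm := measurable_modulusSq hg
  rw [← lintegral_indicator measurableSet_Icc, ← lintegral_indicator measurableSet_Icc,
    lintegral_comp_mul_left two_ne_zero (hm.indicator measurableSet_Icc), abs_two,
    ENNReal.ofReal_ofNat, ← lintegral_const_mul (f := fun x => indicator _ _ (2 * x)) _
      ((hm.indicator measurableSet_Icc).comp (measurable_const_mul 2)),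
    ← lintegral_const_mul _ (hm.indicator measurableSet_Icc)]
  refine lintegral_mono fun s => ?_
  by_cases hs : s ∈ Icc (-r) r
  · rw [indicator_of_mem hs]
    refine (mul_le_mul' le_rfl ((indicator_le_self _ _ _).trans (modulusSq_two_mul_le hg s))).trans ?_
    rw [← mul_assoc]; norm_num
  · rw [indicator_of_notMem, indicator_of_notMem hs]
    · simp
    · contrapose! hs
      constructor <;> linarith [hs.1, hs.2]

lemma lintegral_sq_average_sub_le {g : ℝ × ℝ → ℝ} (hg : Measurable g) {r : ℝ} (hr : 0 ≤ r) :
    ∫⁻ z, (∫⁻ s in Icc (-(2 * r)) (2 * r), ‖g (z.1 + s, z.2) - g z‖ₑ) ^ 2 ∂cylinder ≤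
      ENNReal.ofReal (64 * r) * ∫⁻ s in Icc (-r) r, modulusSq g s := by
  refine (lintegral_sq_lintegral_Icc_le
    (K := fun p => ‖g (p.1.1 + p.2, p.1.2) - g p.1‖ₑ) (by fun_prop)).trans ?_
  refine (mul_le_mul' le_rfl (setLIntegral_modulusSq_two_mul_le hg r)).trans_eq ?_
  rw [← mul_assoc, ← ENNReal.ofReal_ofNat 16, ← ENNReal.ofReal_mul (by positivity)]
  congr 2; ring

/-! ### Rays through the disc; L² bounds for ray integrals and backprojection -/

section Geometry

variable {R RE : ℝ}

/-- These are the frame coordinates of the point. The first bound keeps the Jacobian tR between RE -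
1 and RE + 1 on the disc. -/
lemma abs_lt_of_rayPoint_mem {z : ℝ × ℝ} {t : ℝ} (h : rayPoint R RE z t ∈ imageDomain) :
    |t * R - RE| < 1 ∧ |t * z.1| < 1 := by
  have hn : ‖rayPoint R RE z t‖ < 1 := by simpa [imageDomain] using h
  have h1 := abs_inner_dirPerp_le (rayPoint R RE z t) z.2
  have h2 := abs_inner_dir_le (rayPoint R RE z t) z.2
  have h3 := depth_rayPoint R RE z t
  rw [inner_rayPoint_dir] at h2
  rw [depth] at h3
  refine ⟨?_, h2.trans_lt hn⟩
  rw [← h3]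
  simpa using h1.trans_lt hn

lemma mem_Icc_of_rayPoint_mem (hR : 0 < R) {z : ℝ × ℝ} {t : ℝ}
    (h : rayPoint R RE z t ∈ imageDomain) : t ∈ Icc ((RE - 1) / R) ((RE + 1) / R) := by
  have h1 := abs_lt.1 (abs_lt_of_rayPoint_mem h).1
  rw [mem_Icc, div_le_iff₀ hR, le_div_iff₀ hR]
  constructor <;> linarith [h1.1, h1.2]

lemma depth_mem_Ioo {x : Plane} (hx : x ∈ imageDomain) (α : ℝ) :
    depth RE x α ∈ Ioo (RE - 1) (RE + 1) := by
  have hn : ‖x‖ < 1 := by simpa [imageDomain] using hx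
  have h1 := abs_lt.1 ((abs_inner_dirPerp_le x α).trans_lt hn)
  constructor <;> simp only [depth] <;> linarith [h1.1, h1.2]

lemma abs_offset_le (hRE : 1 < RE) (hR : 0 < R) {x : Plane} (hx : x ∈ imageDomain) (α : ℝ) :
    |offset R RE x α| ≤ R / (RE - 1) := by
  have hn : ‖x‖ < 1 := by simpa [imageDomain] using hx
  have h1 := (depth_mem_Ioo (RE := RE) hx α).1
  have h0 : 0 < RE - 1 := by linarith
  rw [offset, abs_div, abs_mul, abs_of_pos hR, abs_of_pos (h0.trans h1)]
  refine div_le_div₀ hR.le ?_ h0 h1.le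
  nlinarith [abs_inner_dir_le x α]

/-- The integral of `|f|` along a ray. -/
noncomputable def rayNorm (R RE : ℝ) (f : Plane → ℝ) (z : ℝ × ℝ) : ℝ≥0∞ :=
  ∫⁻ t, ‖f (rayPoint R RE z t)‖ₑ

lemma measurable_rayNorm {f : Plane → ℝ} (hf : Measurable f) : Measurable (rayNorm R RE f) := by
  unfold rayNorm
  exact Measurable.lintegral_prod_right'
    (f := fun p : (ℝ × ℝ) × ℝ => ‖f (rayPoint R RE p.1 p.2)‖ₑ) (by fun_prop)

/-- Inserts the Jacobian: where f ≠ 0 the point lies in the disc, so tR > RE - 1. -/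
lemma enorm_ray_le (hRE : 1 < RE) {f : Plane → ℝ}
    (hf0 : ∀ x, x ∉ imageDomain → f x = 0) (z : ℝ × ℝ) (t : ℝ) :
    ‖f (rayPoint R RE z t)‖ₑ ^ 2 ≤ ENNReal.ofReal (1 / (RE - 1)) *
      (ENNReal.ofReal |t * R| * ‖f (rayPoint R RE z t)‖ₑ ^ 2) := by
  by_cases h : rayPoint R RE z t ∈ imageDomain
  · have h1 := abs_lt.1 (abs_lt_of_rayPoint_mem h).1
    have h0 : 0 < RE - 1 := by linarith
    rw [← mul_assoc, ← ENNReal.ofReal_mul (by positivity)]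
    refine le_mul_of_one_le_left' ?_
    rw [ENNReal.one_le_ofReal, one_div, ← div_eq_inv_mul, le_div_iff₀ h0]
    linarith [le_abs_self (t * R), h1.1]
  · simp [hf0 _ h]

/-- A ray meets the disc only for t in an interval of length 2/R. Cauchy–Schwarz there, followed by
`enorm_ray_le`, leaves an integral in fanbeam coordinates. -/
lemma lintegral_rayNorm_sq_le (hRE : 1 < RE) (hR : 0 < R) {f : Plane → ℝ} (hf : Measurable f)
    (hf0 : ∀ x, x ∉ imageDomain → f x = 0) (α : ℝ) :
    ∫⁻ ξ, rayNorm R RE f (ξ, α) ^ 2 ≤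
      ENNReal.ofReal (2 / R * (1 / (RE - 1))) * ∫⁻ x, ‖f x‖ₑ ^ 2 := by
  have hm : Measurable fun p : ℝ × ℝ => rayPoint R RE (p.1, α) p.2 :=
    ((continuous_rayPoint R RE).comp
      (by fun_prop : Continuous fun p : ℝ × ℝ => ((p.1, α), p.2))).measurable
  have key (ξ : ℝ) : rayNorm R RE f (ξ, α) ^ 2 ≤ ENNReal.ofReal (2 / R * (1 / (RE - 1))) *
      ∫⁻ t, ENNReal.ofReal |t * R| * ‖f (rayPoint R RE (ξ, α) t)‖ₑ ^ 2 := by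
    have hmξ : Measurable fun t : ℝ => rayPoint R RE (ξ, α) t := hm.comp (by fun_prop : Measurable fun t : ℝ => (ξ, t))
    have : rayNorm R RE f (ξ, α) =
        ∫⁻ t in Icc ((RE - 1) / R) ((RE + 1) / R), ‖f (rayPoint R RE (ξ, α) t)‖ₑ := by
      rw [← lintegral_indicator measurableSet_Icc, rayNorm]
      refine lintegral_congr fun t => ?_
      by_cases ht : t ∈ Icc ((RE - 1) / R) ((RE + 1) / R)
      · rw [indicator_of_mem ht]
      · rw [indicator_of_notMem ht, hf0 _ fun h => ht (mem_Icc_of_rayPoint_mem hR h), enorm_zero]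
    rw [this]
    refine (sq_lintegral_le _ (hf.comp hmξ).enorm.aemeasurable).trans ?_
    rw [Measure.restrict_apply_univ, Real.volume_Icc, ENNReal.ofReal_mul (by positivity), mul_assoc]
    have e : (RE + 1) / R - (RE - 1) / R = 2 / R := by ring
    rw [e]
    gcongr
    refine (setLIntegral_le_lintegral _ _).trans ?_
    rw [← lintegral_const_mul (f := fun t => ENNReal.ofReal |t * R| *
      ‖f (rayPoint R RE (ξ, α) t)‖ₑ ^ 2) _ (by fun_prop)]
    exact lintegral_mono fun t => enorm_ray_le hRE hf0 _ _
  refine (lintegral_mono key).trans_eq ?_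
  rw [lintegral_plane_eq hR.ne' RE α (h := fun x => ‖f x‖ₑ ^ 2) (by fun_prop), Measure.volume_eq_prod,
    lintegral_prod _ (by fun_prop), lintegral_const_mul]
  exact Measurable.lintegral_prod_right'
    (f := fun p : ℝ × ℝ => ENNReal.ofReal |p.2 * R| * ‖f (rayPoint R RE (p.1, α) p.2)‖ₑ ^ 2)
    (by fun_prop)

lemma lintegral_rayNorm_sq_cylinder_le (hRE : 1 < RE) (hR : 0 < R) {f : Plane → ℝ}
    (hf : Measurable f) (hf0 : ∀ x, x ∉ imageDomain → f x = 0) :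
    ∫⁻ z, rayNorm R RE f z ^ 2 ∂cylinder ≤
      ENNReal.ofReal (2 / R * (1 / (RE - 1)) * (2 * Real.pi)) * ∫⁻ x, ‖f x‖ₑ ^ 2 := by
  have h0 : 0 < RE - 1 := by linarith
  rw [lintegral_cylinder ((measurable_rayNorm hf).pow_const 2)]
  refine (lintegral_mono fun α => lintegral_rayNorm_sq_le hRE hR hf hf0 α).trans_eq ?_
  rw [lintegral_const, Measure.restrict_apply_univ, volume_circle,
    ENNReal.ofReal_mul (p := 2 / R * (1 / (RE - 1))) (by positivity)]
  ring

@[fun_prop]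
lemma measurable_depth : Measurable fun p : Plane × ℝ => depth RE p.1 p.2 := by
  unfold depth; fun_prop

@[fun_prop]
lemma measurable_offset : Measurable fun p : Plane × ℝ => offset R RE p.1 p.2 := by
  unfold offset; fun_prop

lemma measurableSet_imageDomain : MeasurableSet imageDomain := measurableSet_ball

/-- In fanbeam coordinates the integrand depends on ξ alone; the t-integral runs over length at most
2/R with Jacobian at most RE + 1. -/
lemma setLIntegral_offset_le (hRE : 1 < RE) (hR : 0 < R) {H : ℝ → ℝ≥0∞} (hH : Measurable H)
    (α : ℝ) : ∫⁻ x in imageDomain, H (offset R RE x α) ≤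
      ENNReal.ofReal ((RE + 1) * (2 / R)) * ∫⁻ ξ, H ξ := by
  have ho : Measurable fun x : Plane => offset R RE x α := by
    unfold offset depth; fun_prop
  have hm : Measurable fun p : ℝ × ℝ => rayPoint R RE (p.1, α) p.2 :=
    ((continuous_rayPoint R RE).comp
      (by fun_prop : Continuous fun p : ℝ × ℝ => ((p.1, α), p.2))).measurable
  have hi : Measurable (imageDomain.indicator fun x => H (offset R RE x α)) :=
    (hH.comp ho).indicator measurableSet_imageDomain
  rw [← lintegral_indicator measurableSet_imageDomain,
    lintegral_plane_eq hR.ne' RE α hi,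
    Measure.volume_eq_prod, lintegral_prod _ (by fun_prop), ← lintegral_const_mul _ hH]
  refine lintegral_mono fun ξ => ?_
  simp only
  calc _ ≤ ∫⁻ t, (Icc ((RE - 1) / R) ((RE + 1) / R)).indicator
        (fun _ => ENNReal.ofReal (RE + 1) * H ξ) t := by
        refine lintegral_mono fun t => ?_
        by_cases h : rayPoint R RE (ξ, α) t ∈ imageDomain
        · have ht := mem_Icc_of_rayPoint_mem hR h
          have h1 := abs_lt.1 (abs_lt_of_rayPoint_mem h).1
          have ht0 : 0 < t := lt_of_lt_of_le (div_pos (by linarith) hR) ht.1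
          rw [indicator_of_mem h, indicator_of_mem ht,
            offset_rayPoint hR.ne' RE (ξ, α) ht0.ne', abs_of_pos (by positivity)]
          gcongr
          linarith [h1.2]
        · rw [indicator_of_notMem h, mul_zero]; exact zero_le
    _ = _ := by
        rw [lintegral_indicator_const measurableSet_Icc, Real.volume_Icc,
          ENNReal.ofReal_mul (by linarith)]
        have e : (RE + 1) / R - (RE - 1) / R = 2 / R := by ring
        rw [e]; ring

/-- The backprojection is bounded from `L²` to `L²`. -/
lemma lintegral_sq_backprojection_le (hRE : 1 < RE) (hR : 0 < R) {H : ℝ × ℝ → ℝ≥0∞}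
    (hH : Measurable H) :
    ∫⁻ x in imageDomain, (∫⁻ α in circle, H (offset R RE x α, α)) ^ 2 ≤
      ENNReal.ofReal (2 * Real.pi * ((RE + 1) * (2 / R))) * ∫⁻ z, H z ^ 2 ∂cylinder := by
  have ho : Measurable fun p : Plane × ℝ => (offset R RE p.1 p.2, p.2) := by fun_prop
  have hm : Measurable fun p : Plane × ℝ => H (offset R RE p.1 p.2, p.2) := hH.comp ho
  have hr (x : Plane) : Measurable fun α => H (offset R RE x α, α) := by
    have hx : Measurable fun α : ℝ => offset R RE x α := by unfold offset depth; fun_prop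
    exact hH.comp (hx.prodMk measurable_id)
  -- Cauchy–Schwarz in α over the circle of measure 2π, Tonelli, and then `setLIntegral_offset_le`
  -- for each angle.
  calc _ ≤ ∫⁻ x in imageDomain, ENNReal.ofReal (2 * Real.pi) *
        ∫⁻ α in circle, H (offset R RE x α, α) ^ 2 := by
        refine lintegral_mono fun x =>
          (sq_lintegral_le _ (hr x).aemeasurable).trans_eq ?_
        rw [Measure.restrict_apply_univ, volume_circle]
    _ = ENNReal.ofReal (2 * Real.pi) *
        ∫⁻ α in circle, ∫⁻ x in imageDomain, H (offset R RE x α, α) ^ 2 := by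
        rw [lintegral_const_mul _ (Measurable.lintegral_prod_right (by fun_prop)),
          lintegral_lintegral_swap (by fun_prop)]
    _ ≤ ENNReal.ofReal (2 * Real.pi) *
        ∫⁻ α in circle, ENNReal.ofReal ((RE + 1) * (2 / R)) * ∫⁻ ξ, H (ξ, α) ^ 2 := by
        gcongr with α
        exact setLIntegral_offset_le hRE hR (H := fun ξ => H (ξ, α) ^ 2) (by fun_prop) α
    _ = _ := by
        rw [lintegral_const_mul _ (Measurable.lintegral_prod_left (by fun_prop)),
          lintegral_cylinder (by fun_prop),
          ENNReal.ofReal_mul (p := 2 * Real.pi) (by positivity), mul_assoc]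

end Geometry

/-! ### Hat functions and the cells of the detector line -/

section Hat

variable {δ : ℝ}

lemma hat_nonneg (δ t : ℝ) : 0 ≤ Grid.hat δ t := le_max_left _ _

lemma hat_le (hδ : 0 ≤ δ) (t : ℝ) : Grid.hat δ t ≤ δ :=
  max_le hδ (by linarith [abs_nonneg t])

lemma hat_eq_zero {t : ℝ} (h : δ ≤ |t|) : Grid.hat δ t = 0 := max_eq_left (by linarith)

lemma abs_hat_sub_le (δ s t : ℝ) : |Grid.hat δ s - Grid.hat δ t| ≤ |s - t| := by
  have h := abs_max_sub_max_le_abs (δ - |s|) (δ - |t|) 0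
  rw [max_comm _ 0, max_comm _ 0] at h
  refine h.trans ?_
  have e : δ - |s| - (δ - |t|) = -(|s| - |t|) := by ring
  rw [e, abs_neg]
  exact abs_abs_sub_abs_le s t

@[fun_prop]
lemma continuous_hat (δ : ℝ) : Continuous (Grid.hat δ) := by unfold Grid.hat; fun_prop

/-- The center of the cell containing `ξ`, for the partition of `ℝ` into intervals of length `δ`
of which one starts at `-w`. -/
noncomputable def cellCenter (w δ ξ : ℝ) : ℝ := -w + δ * (⌊(ξ + w) / δ⌋ + 1 / 2)

@[fun_prop]
lemma measurable_cellCenter (w δ : ℝ) : Measurable (cellCenter w δ) := by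
  unfold cellCenter
  have : Measurable fun ξ : ℝ => ((⌊(ξ + w) / δ⌋ : ℤ) : ℝ) :=
    (measurable_from_top (f := fun n : ℤ => (n : ℝ))).comp (Int.measurable_floor.comp (by fun_prop))
  fun_prop

lemma cellCenter_eq (hδ : 0 < δ) {w ξ : ℝ} {n : ℤ} (h1 : -w + δ * n ≤ ξ)
    (h2 : ξ < -w + δ * (n + 1)) : cellCenter w δ ξ = -w + δ * (n + 1 / 2) := by
  have : ⌊(ξ + w) / δ⌋ = n := by
    rw [Int.floor_eq_iff, le_div_iff₀ hδ, div_lt_iff₀ hδ]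
    constructor <;> linarith
  rw [cellCenter, this]

lemma cell_bounds (hδ : 0 < δ) (w ξ : ℝ) :
    cellCenter w δ ξ - δ / 2 ≤ ξ ∧ ξ < cellCenter w δ ξ + δ / 2 := by
  have h1 := Int.floor_le ((ξ + w) / δ)
  have h2 := Int.lt_floor_add_one ((ξ + w) / δ)
  rw [le_div_iff₀ hδ] at h1
  rw [div_lt_iff₀ hδ] at h2
  simp only [cellCenter]
  constructor <;> linarith

lemma abs_sub_cellCenter_le (hδ : 0 < δ) (w ξ : ℝ) : |ξ - cellCenter w δ ξ| ≤ δ / 2 := by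
  have h := cell_bounds hδ w ξ
  rw [abs_le]; constructor <;> linarith [h.1, h.2]

lemma integral_hat_sub (hδ : 0 < δ) (c : ℝ) : ∫ y, Grid.hat δ (y - c) = δ ^ 2 := by
  rw [integral_sub_right_eq_self (Grid.hat δ) c]
  have h1 : Grid.hat δ = indicator (Icc (-δ) δ) (fun t => δ - |t|) := by
    ext t
    by_cases ht : t ∈ Icc (-δ) δ
    · rw [indicator_of_mem ht]; exact max_eq_right (by linarith [abs_le.2 ht])
    · rw [indicator_of_notMem ht]
      refine hat_eq_zero ?_
      contrapose! ht
      exact abs_le.1 ht.le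
  rw [h1, integral_indicator measurableSet_Icc, integral_Icc_eq_integral_Ioc,
    ← intervalIntegral.integral_of_le (by linarith),
    ← intervalIntegral.integral_add_adjacent_intervals (b := 0)
      ((by fun_prop : Continuous fun t : ℝ => δ - |t|).intervalIntegrable _ _)
      ((by fun_prop : Continuous fun t : ℝ => δ - |t|).intervalIntegrable _ _)]
  have e1 : ∫ t in (-δ)..0, (δ - |t|) = ∫ t in (-δ)..0, (δ + t) := by
    refine intervalIntegral.integral_congr fun t ht => ?_
    rw [uIcc_of_le (by linarith)] at ht
    simp only [abs_of_nonpos ht.2]; ring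
  have e2 : ∫ t in (0 : ℝ)..δ, (δ - |t|) = ∫ t in (0 : ℝ)..δ, (δ - t) := by
    refine intervalIntegral.integral_congr fun t ht => ?_
    rw [uIcc_of_le (by linarith)] at ht
    simp only [abs_of_nonneg ht.1]
  rw [e1, e2, intervalIntegral.integral_add (by simp) (by simp),
    intervalIntegral.integral_sub (by simp) (by simp)]
  simp
  ring

/-- The hat functions centered at the cell centers form a partition of unity. -/
lemma integral_hat_sub_cellCenter (hδ : 0 < δ) (w y : ℝ) :
    ∫ ξ, Grid.hat δ (y - cellCenter w δ ξ) = δ ^ 2 := by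
  -- This n places y between the adjacent cell centers a + δ/2 and a + 3δ/2. Only the hats at these
  -- two can be nonzero at y; their values add up to δ, and each is taken on a cell of length δ.
  set n : ℤ := ⌊(y + w) / δ - 1 / 2⌋ with hn
  set a : ℝ := -w + δ * n with ha
  have hb : a + δ / 2 ≤ y ∧ y < a + 3 / 2 * δ := by
    have h1 := Int.floor_le ((y + w) / δ - 1 / 2)
    have h2 := Int.lt_floor_add_one ((y + w) / δ - 1 / 2)
    rw [← hn, le_sub_iff_add_le, le_div_iff₀ hδ] at h1
    rw [← hn, sub_lt_iff_lt_add, div_lt_iff₀ hδ] at h2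
    constructor <;> nlinarith
  have key : (fun ξ => Grid.hat δ (y - cellCenter w δ ξ)) = fun ξ =>
      indicator (Ico a (a + δ)) (fun _ => a + 3 / 2 * δ - y) ξ +
        indicator (Ico (a + δ) (a + 2 * δ)) (fun _ => y - a - δ / 2) ξ := by
    ext ξ
    have hc := cell_bounds hδ w ξ
    by_cases h1 : ξ ∈ Ico a (a + δ)
    · have e : cellCenter w δ ξ = a + δ / 2 := by
        rw [cellCenter_eq hδ (n := n) (by linarith [h1.1]) (by linarith [h1.2])]; ring
      rw [indicator_of_mem h1, indicator_of_notMem (fun h => by linarith [h.1, h1.2]), e,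
        Grid.hat, abs_of_nonneg (by linarith), max_eq_right (by linarith)]
      ring
    by_cases h2 : ξ ∈ Ico (a + δ) (a + 2 * δ)
    · have e : cellCenter w δ ξ = a + 3 / 2 * δ := by
        rw [cellCenter_eq hδ (n := n + 1) (by push_cast; linarith [h2.1])
          (by push_cast; linarith [h2.2])]
        push_cast; ring
      rw [indicator_of_notMem h1, indicator_of_mem h2, e,
        Grid.hat, abs_of_nonpos (by linarith), max_eq_right (by linarith)]
      ring
    · rw [indicator_of_notMem h1, indicator_of_notMem h2, add_zero]
      refine hat_eq_zero ?_
      rw [mem_Ico, not_and_or, not_le, not_lt] at h1 h2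
      have hm : ∀ m : ℤ, m = ⌊(ξ + w) / δ⌋ → cellCenter w δ ξ = -w + δ * (m + 1 / 2) := by
        rintro m rfl; rfl
      have h := hm _ rfl
      set m := ⌊(ξ + w) / δ⌋
      rcases h1 with h1 | h1
      · have : m < n := by
          have : δ * (m : ℝ) < δ * n := by linarith
          exact_mod_cast lt_of_mul_lt_mul_left this hδ.le
        have : (m : ℝ) + 1 ≤ n := by exact_mod_cast this
        rw [h, le_abs]; left; nlinarith
      · have h2 : a + 2 * δ ≤ ξ := by
          rcases h2 with h2 | h2
          · linarith
          · exact h2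
        have : n + 1 < m := by
          have : δ * ((n : ℝ) + 1) < δ * m := by linarith
          exact_mod_cast lt_of_mul_lt_mul_left this hδ.le
        have : (n : ℝ) + 2 ≤ m := by exact_mod_cast (by omega : n + 2 ≤ m)
        rw [h, le_abs]; right; nlinarith
  have hi (u v e : ℝ) : Integrable (indicator (Ico u v) fun _ => e) :=
    (integrable_indicator_iff measurableSet_Ico).2 (integrableOn_const (by simp))
  rw [key, integral_add (hi _ _ _) (hi _ _ _), integral_indicator_const _ measurableSet_Ico,
    integral_indicator_const _ measurableSet_Ico]
  simp [hδ.le]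
  rw [max_eq_left (by linarith)]
  ring

end Hat

/-! ### Detector pixels, angular cells and image pixels as partitions -/

namespace Grid

variable (D : Grid) {R RE : ℝ}

lemma detectorWidth_pos (hRE : 1 < RE) (hR : 0 < R) : 0 < detectorWidth R RE := by
  have : 0 < RE ^ 2 - 1 := by nlinarith
  unfold detectorWidth; positivity

lemma detectorSize_pos (hRE : 1 < RE) (hR : 0 < R) : 0 < D.detectorSize R RE := by
  have h := D.one_le_P
  have := detectorWidth_pos hRE hR
  have : (0 : ℝ) < D.P := by exact_mod_cast h
  unfold detectorSize; positivity

lemma detectorSize_mul (R RE : ℝ) : D.detectorSize R RE * D.P = detectorWidth R RE := by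
  have h := D.one_le_P
  have : (D.P : ℝ) ≠ 0 := by exact_mod_cast (by omega : D.P ≠ 0)
  unfold detectorSize; field_simp

lemma mem_detectorPixel_iff {p : ℕ} {ξ : ℝ} : ξ ∈ D.detectorPixel R RE p ↔
    -(detectorWidth R RE / 2) + D.detectorSize R RE * ((p : ℝ) - 1) ≤ ξ ∧
      ξ < -(detectorWidth R RE / 2) + D.detectorSize R RE * p := by
  rw [detectorPixel, mem_Ico, detectorOffset, ← D.detectorSize_mul R RE]
  constructor <;> rintro ⟨h1, h2⟩ <;> constructor <;> linarith

/-- Pixels are numbered from 1 and cells from 0, hence the index p - 1 in the proof. The pixel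
center thereby becomes a function of ξ that makes sense on all of ℝ. -/
lemma detectorOffset_eq_cellCenter (hδ : 0 < D.detectorSize R RE) {p : ℕ} {ξ : ℝ}
    (h : ξ ∈ D.detectorPixel R RE p) :
    D.detectorOffset R RE p = cellCenter (detectorWidth R RE / 2) (D.detectorSize R RE) ξ := by
  rw [mem_detectorPixel_iff] at h
  rw [cellCenter_eq hδ (n := (p : ℤ) - 1) (by push_cast; exact h.1) (by push_cast; linarith [h.2]),
    detectorOffset, ← D.detectorSize_mul R RE]
  push_cast; ring

lemma exists_detectorPixel (hδ : 0 < D.detectorSize R RE) {ξ : ℝ}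
    (h : ξ ∈ Ioo (-(detectorWidth R RE / 2)) (detectorWidth R RE / 2)) :
    ∃ p ∈ Finset.Icc 1 D.P, ξ ∈ D.detectorPixel R RE p := by
  have hW := D.detectorSize_mul R RE
  set δ := D.detectorSize R RE
  set y := (ξ + detectorWidth R RE / 2) / δ with hy
  have hy0 : 0 ≤ y := div_nonneg (by linarith [h.1]) hδ.le
  have hyP : y < D.P := by rw [hy, div_lt_iff₀ hδ]; linarith [h.2]
  have h1 := Nat.floor_le hy0
  have h2 := Nat.lt_floor_add_one y
  have h3 : ⌊y⌋₊ < D.P := (Nat.floor_lt hy0).2 hyP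
  refine ⟨⌊y⌋₊ + 1, Finset.mem_Icc.2 ⟨by omega, by omega⟩, ?_⟩
  rw [mem_detectorPixel_iff]
  rw [hy, le_div_iff₀ hδ, ← hy] at h1
  rw [hy, div_lt_iff₀ hδ, ← hy] at h2
  push_cast
  constructor <;> linarith

lemma detectorPixel_unique (hδ : 0 < D.detectorSize R RE) {p p' : ℕ} {ξ : ℝ}
    (h : ξ ∈ D.detectorPixel R RE p) (h' : ξ ∈ D.detectorPixel R RE p') : p = p' := by
  rw [mem_detectorPixel_iff] at h h'
  have h1 : (p : ℝ) - 1 < p' := lt_of_mul_lt_mul_left (by linarith [h.1, h'.2]) hδ.le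
  have h2 : (p' : ℝ) - 1 < p := lt_of_mul_lt_mul_left (by linarith [h'.1, h.2]) hδ.le
  have h1' : (p : ℝ) < p' + 1 := by linarith
  have h2' : (p' : ℝ) < p + 1 := by linarith
  norm_cast at h1' h2'
  omega

lemma angleExt_zero : D.angleExt 0 = D.angle D.Q - 2 * Real.pi := if_pos rfl

lemma angleExt_last : D.angleExt (D.Q + 1) = D.angle 1 + 2 * Real.pi := by
  rw [angleExt, if_neg (by omega), if_pos rfl]

lemma angleExt_of_mem {q : ℕ} (h1 : 1 ≤ q) (h2 : q ≤ D.Q) : D.angleExt q = D.angle q := by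
  rw [angleExt, if_neg (by omega), if_neg (by omega)]

lemma angleExt_lt_succ {q : ℕ} (hq : q ≤ D.Q) : D.angleExt q < D.angleExt (q + 1) := by
  have hQ := D.one_le_Q
  have m1 := D.angle_mem 1 (Finset.mem_Icc.2 ⟨le_rfl, hQ⟩)
  have mQ := D.angle_mem D.Q (Finset.mem_Icc.2 ⟨hQ, le_rfl⟩)
  simp only [circle, mem_Ico] at m1 mQ
  rcases Nat.eq_zero_or_pos q with rfl | h
  · rw [angleExt_zero, angleExt_of_mem _ (by omega) (by omega)]
    linarith [m1.1, mQ.2]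
  rcases hq.eq_or_lt with rfl | h'
  · rw [angleExt_last, angleExt_of_mem _ h le_rfl]
    linarith [m1.1, mQ.2]
  · rw [angleExt_of_mem _ h hq, angleExt_of_mem _ (by omega) h']
    exact D.angle_strictMono ⟨h, hq⟩ ⟨by omega, h'⟩ (by omega)

lemma angleLength_pos {q : ℕ} (hq : q ∈ Finset.Icc 1 D.Q) : 0 < D.angleLength q := by
  rw [Finset.mem_Icc] at hq
  have h1 := D.angleExt_lt_succ hq.2
  have h2 := D.angleExt_lt_succ (q := q - 1) (by omega)
  rw [show q - 1 + 1 = q by omega] at h2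
  unfold angleLength; linarith

/-- The maximum defining `angleWidth` starts at q = 1; the gap at q = 0 is a translate by 2π of the
gap at q = Q. -/
lemma angleExt_succ_sub_le (q : ℕ) (hq : q ≤ D.Q) :
    D.angleExt (q + 1) - D.angleExt q ≤ D.angleWidth := by
  have hQ := D.one_le_Q
  have key : ∀ q ∈ Finset.Icc 1 D.Q, D.angleExt (q + 1) - D.angleExt q ≤ D.angleWidth :=
    fun q hq => Finset.le_sup' (fun q => D.angleExt (q + 1) - D.angleExt q) hq
  rcases Nat.eq_zero_or_pos q with rfl | h
  · refine le_trans (le_of_eq ?_) (key D.Q (Finset.mem_Icc.2 ⟨hQ, le_rfl⟩))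
    rw [zero_add, angleExt_zero, angleExt_last, D.angleExt_of_mem le_rfl hQ,
      D.angleExt_of_mem hQ le_rfl]
    ring
  · exact key q (Finset.mem_Icc.2 ⟨h, hq⟩)

/-- The end points of the angular cells. -/
noncomputable def angleMid (q : ℕ) : ℝ := (D.angleExt q + D.angleExt (q + 1)) / 2

lemma angleMid_mono {q q' : ℕ} (h : q ≤ q') (hq' : q' ≤ D.Q) : D.angleMid q ≤ D.angleMid q' := by
  induction q', h using Nat.le_induction with
  | base => exact le_rfl
  | succ n hn ih =>
    refine (ih (by omega)).trans ?_
    have h1 := D.angleExt_lt_succ (q := n) (by omega)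
    have h2 := D.angleExt_lt_succ (q := n + 1) hq'
    unfold angleMid; linarith

lemma angleMid_Q : D.angleMid D.Q = D.angleMid 0 + 2 * Real.pi := by
  have hQ := D.one_le_Q
  rw [angleMid, angleMid, zero_add, angleExt_zero, angleExt_last, D.angleExt_of_mem le_rfl hQ,
    D.angleExt_of_mem hQ le_rfl]
  ring

lemma mem_angleCell_iff {q : ℕ} (hq : q ∈ Finset.Icc 1 D.Q) {α : ℝ} :
    α ∈ D.angleCell q ↔ α ∈ circle ∧ ∃ k : ℤ,
      α + 2 * Real.pi * k ∈ Ico (D.angleMid (q - 1)) (D.angleMid q) := by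
  rw [Finset.mem_Icc] at hq
  unfold angleCell angleMid
  rw [show q - 1 + 1 = q by omega]
  rfl

lemma exists_angleCell {α : ℝ} (hα : α ∈ circle) :
    ∃ q ∈ Finset.Icc 1 D.Q, α ∈ D.angleCell q := by
  -- The cell end points run from `angleMid 0` to `angleMid Q`, a full period. Reduce α into this
  -- interval and take the least q whose right end point lies beyond it.
  have hmod := toIcoMod_mem_Ico Real.two_pi_pos (D.angleMid 0) α
  set a := toIcoMod Real.two_pi_pos (D.angleMid 0) α with ha
  rw [← angleMid_Q] at hmod
  have hex : ∃ q, a < D.angleMid q := ⟨_, hmod.2⟩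
  classical
  have hf := Nat.find_spec hex
  have hle : Nat.find hex ≤ D.Q := Nat.find_min' hex hmod.2
  have hpos : Nat.find hex ≠ 0 := fun h => by
    rw [h] at hf; linarith [hmod.1]
  have hpred := Nat.find_min hex (m := Nat.find hex - 1) (by omega)
  have hq : Nat.find hex ∈ Finset.Icc 1 D.Q := Finset.mem_Icc.2 ⟨by omega, hle⟩
  refine ⟨_, hq, (D.mem_angleCell_iff hq).2
    ⟨hα, -toIcoDiv Real.two_pi_pos (D.angleMid 0) α, ?_⟩⟩
  have e : α + 2 * Real.pi * ((-toIcoDiv Real.two_pi_pos (D.angleMid 0) α : ℤ) : ℝ) = a := by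
    rw [ha, toIcoMod, zsmul_eq_mul]; push_cast; ring
  rw [e]
  exact ⟨not_lt.1 hpred, hf⟩

lemma angleCell_unique {q q' : ℕ} (hq : q ∈ Finset.Icc 1 D.Q) (hq' : q' ∈ Finset.Icc 1 D.Q)
    {α : ℝ} (h : α ∈ D.angleCell q) (h' : α ∈ D.angleCell q') : q = q' := by
  rw [mem_angleCell_iff _ hq] at h
  rw [mem_angleCell_iff _ hq'] at h'
  obtain ⟨-, k, hk⟩ := h
  obtain ⟨-, k', hk'⟩ := h'
  rw [Finset.mem_Icc] at hq hq'
  have hpi := Real.pi_pos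
  have hQ := D.angleMid_Q
  have b1 := D.angleMid_mono (q := 0) (q' := q - 1) (by omega) (by omega)
  have b2 := D.angleMid_mono (q := q) (q' := D.Q) (by omega) (by omega)
  have b3 := D.angleMid_mono (q := 0) (q' := q' - 1) (by omega) (by omega)
  have b4 := D.angleMid_mono (q := q') (q' := D.Q) (by omega) (by omega)
  -- Both translates of α lie in the same half-open interval of length 2π.
  have e : k = k' := by
    have h1 : (k : ℝ) < k' + 1 :=
      lt_of_mul_lt_mul_left (by linarith [hk.1, hk.2, hk'.1, hk'.2]) Real.two_pi_pos.le
    have h2 : (k' : ℝ) < k + 1 :=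
      lt_of_mul_lt_mul_left (by linarith [hk.1, hk.2, hk'.1, hk'.2]) Real.two_pi_pos.le
    norm_cast at h1 h2
    omega
  subst e
  by_contra hne
  rcases Nat.lt_or_gt_of_ne hne with hlt | hlt
  · have := D.angleMid_mono (q := q) (q' := q' - 1) (by omega) (by omega)
    linarith [hk.2, hk'.1]
  · have := D.angleMid_mono (q := q') (q' := q - 1) (by omega) (by omega)
    linarith [hk'.2, hk.1]

/-- A cell may wrap around the ends of [-π, π), so closeness to its angle holds only modulo 2π. -/
lemma abs_sub_angle_le {q : ℕ} (hq : q ∈ Finset.Icc 1 D.Q) {α : ℝ} (h : α ∈ D.angleCell q) :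
    ∃ k : ℤ, |α + 2 * Real.pi * k - D.angle q| ≤ D.angleWidth := by
  obtain ⟨-, k, hk⟩ := h
  rw [Finset.mem_Icc] at hq
  have h1 := D.angleExt_succ_sub_le q hq.2
  have h2 := D.angleExt_succ_sub_le (q - 1) (by omega)
  have h1' := D.angleExt_lt_succ (q := q) hq.2
  have h2' := D.angleExt_lt_succ (q := q - 1) (by omega)
  rw [show q - 1 + 1 = q by omega] at h2 h2'
  rw [← D.angleExt_of_mem hq.1 hq.2]
  refine ⟨k, abs_le.2 ⟨?_, ?_⟩⟩ <;> linarith [hk.1, hk.2]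

lemma measurableSet_angleCell (q : ℕ) : MeasurableSet (D.angleCell q) := by
  have : D.angleCell q = circle ∩ ⋃ k : ℤ, (fun α : ℝ => α + 2 * Real.pi * k) ⁻¹'
      Ico ((D.angleExt (q - 1) + D.angleExt q) / 2) ((D.angleExt q + D.angleExt (q + 1)) / 2) := by
    ext α; simp only [angleCell, mem_ofPred_eq, mem_inter_iff, mem_iUnion, mem_preimage]
  rw [this]
  exact measurableSet_circle.inter
    (MeasurableSet.iUnion fun k => (by fun_prop : Measurable _) measurableSet_Ico)

lemma measurableSet_detectorPixel (p : ℕ) : MeasurableSet (D.detectorPixel R RE p) :=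
  measurableSet_Ico

lemma measurableSet_pixel (i j : ℕ) : MeasurableSet (D.pixel i j) := by
  have : D.pixel i j = ⋂ k, (fun x : Plane => x k) ⁻¹' Ico (D.pixelCenter i j k - D.pixelSize / 2)
      (D.pixelCenter i j k + D.pixelSize / 2) := by
    ext x; simp [pixel]
  rw [this]
  exact MeasurableSet.iInter fun k => (by fun_prop : Measurable _) measurableSet_Ico

lemma pixel_unique {i j i' j' : ℕ} {x : Plane} (h : x ∈ D.pixel i j) (h' : x ∈ D.pixel i' j') :
    i = i' ∧ j = j' := by
  have hp := D.pixelSize_pos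
  have key : ∀ {a b : ℕ} {u v : ℝ}, v ∈ Ico (D.pixelSize * (a - u) - D.pixelSize / 2)
      (D.pixelSize * (a - u) + D.pixelSize / 2) → v ∈ Ico (D.pixelSize * (b - u) - D.pixelSize / 2)
      (D.pixelSize * (b - u) + D.pixelSize / 2) → a = b := by
    intro a b u v h1 h2
    have h3 : (a : ℝ) < b + 1 :=
      lt_of_mul_lt_mul_left (by linarith [h1.1, h1.2, h2.1, h2.2]) hp.le
    have h4 : (b : ℝ) < a + 1 :=
      lt_of_mul_lt_mul_left (by linarith [h1.1, h1.2, h2.1, h2.2]) hp.le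
    norm_cast at h3 h4
    omega
  exact ⟨key (by simpa [pixelCenter] using h 0) (by simpa [pixelCenter] using h' 0),
    key (by simpa [pixelCenter] using h 1) (by simpa [pixelCenter] using h' 1)⟩

lemma norm_pixelCenter_sub_le {i j : ℕ} {x : Plane} (h : x ∈ D.pixel i j) :
    ‖D.pixelCenter i j - x‖ ≤ D.pixelSize := by
  have hp := D.pixelSize_pos
  rw [EuclideanSpace.norm_eq, Real.sqrt_le_left hp.le]
  have key (k : Fin 2) : ‖(D.pixelCenter i j - x) k‖ ^ 2 ≤ (D.pixelSize / 2) ^ 2 := by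
    have hk := h k
    rw [Real.norm_eq_abs, sq_abs, PiLp.sub_apply]
    refine sq_le_sq' ?_ ?_ <;> linarith [hk.1, hk.2]
  rw [Fin.sum_univ_two]
  nlinarith [key 0, key 1]

end Grid

/-! ### Lipschitz bounds for offset, depth and kernel -/

section Kernel

variable {R RE : ℝ}

lemma norm_dir_sub_le (a b : ℝ) : ‖dir a - dir b‖ ≤ 2 * |a - b| := by
  rw [EuclideanSpace.norm_eq, Real.sqrt_le_left (by positivity), Fin.sum_univ_two]
  simp only [dir, PiLp.sub_apply, Real.norm_eq_abs, sq_abs, mul_pow]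
  simp
  have h1 := sq_le_sq.2 ((Real.abs_sin_sub_sin_le a b).trans (le_abs_self _))
  have h2 := sq_le_sq.2 ((Real.abs_cos_sub_cos_le a b).trans (le_abs_self _))
  rw [sq_abs] at h1 h2
  nlinarith [sq_nonneg (a - b)]

lemma dirPerp_eq_dir (a : ℝ) : dirPerp a = dir (a + Real.pi / 2) := by
  ext i; fin_cases i <;> simp [dir, dirPerp, Real.cos_add_pi_div_two, Real.sin_add_pi_div_two]

lemma norm_dirPerp_sub_le (a b : ℝ) : ‖dirPerp a - dirPerp b‖ ≤ 2 * |a - b| := by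
  rw [dirPerp_eq_dir, dirPerp_eq_dir]
  simpa using norm_dir_sub_le (a + Real.pi / 2) (b + Real.pi / 2)

lemma dir_add_int_mul (a : ℝ) (k : ℤ) : dir (a + 2 * Real.pi * k) = dir a := by
  rw [dir, dir, show a + 2 * Real.pi * k = a + k * (2 * Real.pi) by ring,
    Real.cos_add_int_mul_two_pi, Real.sin_add_int_mul_two_pi]

lemma dirPerp_add_int_mul (a : ℝ) (k : ℤ) : dirPerp (a + 2 * Real.pi * k) = dirPerp a := by
  rw [dirPerp_eq_dir, dirPerp_eq_dir, ← dir_add_int_mul (a + Real.pi / 2) k]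
  congr 1; ring

lemma abs_inner_sub_inner_le {x y u v : Plane} (hx : ‖x‖ ≤ 1) (hu : ‖u‖ = 1) {η : ℝ}
    (hxy : ‖y - x‖ ≤ η) (huv : ‖u - v‖ ≤ 2 * η) :
    |inner ℝ y u - inner ℝ x v| ≤ 3 * η := by
  have e : inner ℝ y u - inner ℝ x v = inner ℝ (y - x) u + inner ℝ x (u - v) := by
    rw [inner_sub_left, inner_sub_right]; ring
  have h1 := abs_real_inner_le_norm (y - x) u
  have h2 := abs_real_inner_le_norm x (u - v)
  rw [e]
  refine (abs_add_le _ _).trans ?_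
  rw [hu, mul_one] at h1
  nlinarith [norm_nonneg (u - v)]

/-- A Lipschitz constant of the detector offset near the image domain. -/
noncomputable def offsetLip (R RE : ℝ) : ℝ := R * (6 / (RE - 1) + 6 / (RE - 1) ^ 2)

lemma offsetLip_nonneg (hRE : 1 < RE) (hR : 0 < R) : 0 ≤ offsetLip R RE := by
  have : 0 < RE - 1 := by linarith
  unfold offsetLip; positivity

variable {x y : Plane} {α β η : ℝ}

lemma abs_depth_sub_le (hx : x ∈ imageDomain) (hxy : ‖y - x‖ ≤ η)
    (hαβ : ∃ k : ℤ, |α + 2 * Real.pi * k - β| ≤ η) :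
    |depth RE y β - depth RE x α| ≤ 3 * η := by
  obtain ⟨k, hk⟩ := hαβ
  have hn : ‖x‖ < 1 := by simpa [imageDomain] using hx
  have h := norm_dirPerp_sub_le β (α + 2 * Real.pi * k)
  rw [dirPerp_add_int_mul, abs_sub_comm] at h
  have := abs_inner_sub_inner_le hn.le (norm_dirPerp β) hxy (h.trans (by linarith))
  simpa [depth] using this

lemma abs_inner_dir_sub_le (hx : x ∈ imageDomain) (hxy : ‖y - x‖ ≤ η)
    (hαβ : ∃ k : ℤ, |α + 2 * Real.pi * k - β| ≤ η) :
    |inner ℝ y (dir β) - inner ℝ x (dir α)| ≤ 3 * η := by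
  obtain ⟨k, hk⟩ := hαβ
  have hn : ‖x‖ < 1 := by simpa [imageDomain] using hx
  have h := norm_dir_sub_le β (α + 2 * Real.pi * k)
  rw [dir_add_int_mul, abs_sub_comm] at h
  exact abs_inner_sub_inner_le hn.le (norm_dir β) hxy (h.trans (by linarith))

/-- The depth exceeds RE - 1 on the disc and changes by at most 3η. Thus the smallness of η rules
out division by zero at the centers of pixels that meet the disc. -/
lemma half_le_depth (hx : x ∈ imageDomain) (hxy : ‖y - x‖ ≤ η)
    (hαβ : ∃ k : ℤ, |α + 2 * Real.pi * k - β| ≤ η) (hη : 6 * η ≤ RE - 1) :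
    (RE - 1) / 2 ≤ depth RE y β := by
  have h1 := abs_le.1 (abs_depth_sub_le (RE := RE) hx hxy hαβ)
  have h2 := (depth_mem_Ioo (RE := RE) hx α).1
  linarith [h1.1]

/-- Here q is the depth at the exact point and p the depth at the perturbed one, where only half of
the lower bound survives. -/
lemma abs_div_sub_div_le {a b p q e m u : ℝ} (hm : 0 < m) (hp : m / 2 ≤ p) (hq : m ≤ q)
    (hab : |a - b| ≤ u) (hpq : |p - q| ≤ e) :
    |a / p - b / q| ≤ 2 * u / m + |b| * (2 * e / m ^ 2) := by
  have hp0 : 0 < p := by linarith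
  have hq0 : 0 < q := by linarith
  have hu := (abs_nonneg _).trans hab
  have he := (abs_nonneg _).trans hpq
  have e1 : a / p - b / q = (a - b) / p + b * ((q - p) / (p * q)) := by field_simp; ring
  rw [e1]
  refine (abs_add_le _ _).trans ?_
  rw [abs_mul, abs_div, abs_div, abs_of_pos hp0, abs_of_pos (mul_pos hp0 hq0), abs_sub_comm q p]
  have h1 : |a - b| / p ≤ 2 * u / m := by
    rw [show 2 * u / m = u / (m / 2) by field_simp]
    exact div_le_div₀ hu hab (by positivity) hp
  have h2 : |p - q| / (p * q) ≤ 2 * e / m ^ 2 := by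
    rw [show 2 * e / m ^ 2 = e / (m / 2 * m) by field_simp]
    exact div_le_div₀ he hpq (by positivity) (mul_le_mul hp hq hm.le hp0.le)
  gcongr

lemma abs_offset_sub_le (hRE : 1 < RE) (hR : 0 < R) (hx : x ∈ imageDomain) (hxy : ‖y - x‖ ≤ η)
    (hαβ : ∃ k : ℤ, |α + 2 * Real.pi * k - β| ≤ η) (hη : 6 * η ≤ RE - 1) :
    |offset R RE y β - offset R RE x α| ≤ offsetLip R RE * η := by
  have hm : 0 < RE - 1 := by linarith
  have hn : ‖x‖ < 1 := by simpa [imageDomain] using hx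
  have h := abs_div_sub_div_le hm (half_le_depth hx hxy hαβ hη)
    (depth_mem_Ioo (RE := RE) hx α).1.le (abs_inner_dir_sub_le hx hxy hαβ)
    (abs_depth_sub_le (RE := RE) hx hxy hαβ)
  have hη0 : 0 ≤ η := (norm_nonneg _).trans hxy
  have e : offset R RE y β - offset R RE x α =
      R * (inner ℝ y (dir β) / depth RE y β - inner ℝ x (dir α) / depth RE x α) := by
    simp only [offset]; ring
  have h1 : |inner ℝ x (dir α)| ≤ 1 := (abs_inner_dir_le x α).trans hn.le
  have h2 : |inner ℝ x (dir α)| * (2 * (3 * η) / (RE - 1) ^ 2) ≤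
      1 * (2 * (3 * η) / (RE - 1) ^ 2) := by gcongr
  rw [e, abs_mul, abs_of_pos hR, offsetLip, mul_assoc]
  refine mul_le_mul_of_nonneg_left ((h.trans (add_le_add_right h2 _)).trans_eq ?_) hR.le
  ring

/-- A Lipschitz constant of the pixel-driven kernel. -/
noncomputable def kernelLip (R RE : ℝ) : ℝ :=
  2 * offsetLip R RE / (RE - 1) + 6 / (RE - 1) ^ 2

lemma kernelLip_nonneg (hRE : 1 < RE) (hR : 0 < R) : 0 ≤ kernelLip R RE := by
  have := offsetLip_nonneg hRE hR
  have : 0 < RE - 1 := by linarith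
  unfold kernelLip; positivity

/-- The hat is 1-Lipschitz for every δ and at most 1 for δ ≤ 1, so the constant is independent of δ.
-/
lemma abs_kernel_sub_le (hRE : 1 < RE) (hR : 0 < R) (hx : x ∈ imageDomain) (hxy : ‖y - x‖ ≤ η)
    (hαβ : ∃ k : ℤ, |α + 2 * Real.pi * k - β| ≤ η) (hη : 6 * η ≤ RE - 1) {δ : ℝ} (hδ : 0 < δ)
    (hδ1 : δ ≤ 1) (c : ℝ) :
    |Grid.hat δ (offset R RE y β - c) / depth RE y β -
      Grid.hat δ (offset R RE x α - c) / depth RE x α| ≤ kernelLip R RE * η := by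
  have hm : 0 < RE - 1 := by linarith
  have hη0 : 0 ≤ η := (norm_nonneg _).trans hxy
  have h0 : |Grid.hat δ (offset R RE y β - c) - Grid.hat δ (offset R RE x α - c)| ≤
      offsetLip R RE * η := by
    refine (abs_hat_sub_le _ _ _).trans ?_
    simpa using abs_offset_sub_le hRE hR hx hxy hαβ hη
  refine (abs_div_sub_div_le hm (half_le_depth hx hxy hαβ hη)
    (depth_mem_Ioo (RE := RE) hx α).1.le h0
    (abs_depth_sub_le (RE := RE) hx hxy hαβ)).trans ?_
  have h1 : |Grid.hat δ (offset R RE x α - c)| ≤ 1 := by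
    rw [abs_of_nonneg (hat_nonneg _ _)]
    exact (hat_le hδ.le _).trans hδ1
  have h2 : |Grid.hat δ (offset R RE x α - c)| * (2 * (3 * η) / (RE - 1) ^ 2) ≤
      1 * (2 * (3 * η) / (RE - 1) ^ 2) := by gcongr
  refine (add_le_add_right h2 _).trans_eq ?_
  rw [kernelLip]; ring

/-- The offset moves by at most `offsetLip R RE * η`, so both hats vanish. This confines the kernel
error to a strip whose width is of order δ, which gains a factor δ against η/δ². -/
lemma kernel_sub_eq_zero (hRE : 1 < RE) (hR : 0 < R) (hx : x ∈ imageDomain) (hxy : ‖y - x‖ ≤ η)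
    (hαβ : ∃ k : ℤ, |α + 2 * Real.pi * k - β| ≤ η) (hη : 6 * η ≤ RE - 1) {δ : ℝ} (c : ℝ)
    (h : δ + offsetLip R RE * η ≤ |offset R RE x α - c|) :
    Grid.hat δ (offset R RE y β - c) / depth RE y β -
      Grid.hat δ (offset R RE x α - c) / depth RE x α = 0 := by
  have hη0 : 0 ≤ η := (norm_nonneg _).trans hxy
  have hL := mul_nonneg (offsetLip_nonneg hRE hR) hη0
  have h1 := abs_offset_sub_le hRE hR hx hxy hαβ hη
  have h2 : |offset R RE x α - c| ≤ |offset R RE y β - c| + |offset R RE y β - offset R RE x α| := by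
    rw [abs_sub_comm (offset R RE y β) (offset R RE x α), add_comm]
    exact abs_sub_le _ _ _
  rw [hat_eq_zero (by linarith), hat_eq_zero (by linarith)]
  simp

end Kernel

/-! ### The discrete operators as integral operators -/

namespace Grid

variable (D : Grid) {R RE : ℝ}

lemma sum_indicator_mul {ι X : Type*} {s : Finset ι} {A : ι → Set X} {i : ι} (hi : i ∈ s) {x : X}
    (hx : x ∈ A i) (hu : ∀ j ∈ s, x ∈ A j → j = i) (F : ι → ℝ) :
    ∑ j ∈ s, (A j).indicator (1 : X → ℝ) x * F j = F i := by
  rw [Finset.sum_eq_single i]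
  · simp [indicator_of_mem hx]
  · intro j hj hne
    rw [indicator_of_notMem fun h => hne (hu j hj h), zero_mul]
  · exact fun h => absurd hi h

lemma sum_pixel_indicator_mul {x : Plane} {i j : ℕ} (hi : i ∈ Finset.Icc 1 D.N)
    (hj : j ∈ Finset.Icc 1 D.M) (hx : x ∈ D.pixel i j) (F : ℕ → ℕ → ℝ) :
    ∑ i ∈ Finset.Icc 1 D.N, ∑ j ∈ Finset.Icc 1 D.M, (D.pixel i j).indicator (1 : Plane → ℝ) x * F i j =
      F i j := by
  rw [← Finset.sum_product']
  exact sum_indicator_mul (A := fun p : ℕ × ℕ => D.pixel p.1 p.2) (i := (i, j))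
    (Finset.mem_product.2 ⟨hi, hj⟩) hx
    (fun p _ hp => Prod.ext (D.pixel_unique hp hx).1 (D.pixel_unique hp hx).2) fun p => F p.1 p.2

lemma sum_cell_indicator_mul (hδ : 0 < D.detectorSize R RE) {z : ℝ × ℝ} {p q : ℕ}
    (hp : p ∈ Finset.Icc 1 D.P) (hq : q ∈ Finset.Icc 1 D.Q) (hzp : z.1 ∈ D.detectorPixel R RE p)
    (hzq : z.2 ∈ D.angleCell q) (F : ℕ → ℕ → ℝ) :
    ∑ p ∈ Finset.Icc 1 D.P, ∑ q ∈ Finset.Icc 1 D.Q,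
      (D.detectorPixel R RE p ×ˢ D.angleCell q).indicator (1 : ℝ × ℝ → ℝ) z * F p q = F p q := by
  rw [← Finset.sum_product']
  exact sum_indicator_mul
    (A := fun u : ℕ × ℕ => D.detectorPixel R RE u.1 ×ˢ D.angleCell u.2) (i := (p, q))
    (Finset.mem_product.2 ⟨hp, hq⟩) ⟨hzp, hzq⟩
    (fun u hu h => Prod.ext (D.detectorPixel_unique hδ h.1 hzp)
      (D.angleCell_unique (Finset.mem_product.1 hu).2 hq h.2 hzq)) fun u => F u.1 u.2

lemma exists_pixel (hD : D.Covers) {x : Plane} (hx : x ∈ imageDomain) :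
    ∃ i ∈ Finset.Icc 1 D.N, ∃ j ∈ Finset.Icc 1 D.M, x ∈ D.pixel i j := by
  have := hD hx
  simpa only [mem_iUnion, exists_prop] using this

lemma integrable_indicator_mul_mul {X : Type*} [MeasurableSpace X] {μ : Measure X} {A : Set X}
    (hA : MeasurableSet A) {f : X → ℝ} (hf : Integrable f μ) (a : ℝ) :
    Integrable (fun x => A.indicator 1 x * a * f x) μ := by
  have e : (fun x => A.indicator 1 x * a * f x) = A.indicator fun x => a * f x := by
    ext x; by_cases h : x ∈ A <;> simp [h]
  rw [e]
  exact (hf.const_mul a).indicator hA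

lemma integral_indicator_mul_mul {X : Type*} [MeasurableSpace X] {μ : Measure X} {A : Set X}
    (hA : MeasurableSet A) (f : X → ℝ) (a : ℝ) :
    ∫ x, A.indicator 1 x * a * f x ∂μ = a * ∫ x in A, f x ∂μ := by
  have e : (fun x => A.indicator 1 x * a * f x) = A.indicator fun x => a * f x := by
    ext x; by_cases h : x ∈ A <;> simp [h]
  rw [e, integral_indicator hA, integral_const_mul]

/-- The discrete transform as an integral operator. -/
lemma exists_discreteTransform_eq (hδ : 0 < D.detectorSize R RE) (hD : D.Covers) {f : Plane → ℝ}
    (hf : Integrable f) {z : ℝ × ℝ} (hz : z ∈ sinogramDomain R RE) :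
    ∃ β, (∃ k : ℤ, |z.2 + 2 * Real.pi * k - β| ≤ D.angleWidth) ∧ ∃ φ : Plane → ℝ,
      Integrable (fun x => φ x * f x) ∧
      (∀ x ∈ imageDomain, ∃ y, ‖y - x‖ ≤ D.pixelSize ∧
        φ x = hat (D.detectorSize R RE) (offset R RE y β -
          cellCenter (detectorWidth R RE / 2) (D.detectorSize R RE) z.1) / depth RE y β) ∧
      D.discreteTransform R RE f z = 1 / D.detectorSize R RE ^ 2 *
        √(cellCenter (detectorWidth R RE / 2) (D.detectorSize R RE) z.1 ^ 2 + R ^ 2) *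
          ∫ x, φ x * f x := by
  obtain ⟨p, hp, hzp⟩ := D.exists_detectorPixel hδ hz.1
  obtain ⟨q, hq, hzq⟩ := D.exists_angleCell hz.2
  rw [← D.detectorOffset_eq_cellCenter hδ hzp]
  set c := D.detectorOffset R RE p
  let F : ℕ → ℕ → ℝ := fun i j =>
    hat (D.detectorSize R RE) (offset R RE (D.pixelCenter i j) (D.angle q) - c) /
      depth RE (D.pixelCenter i j) (D.angle q)
  have hint (i j : ℕ) : Integrable fun x => (D.pixel i j).indicator 1 x * F i j * f x :=
    integrable_indicator_mul_mul (D.measurableSet_pixel i j) hf _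
  -- The kernel is constant on each pixel, so the factor δ_x² times the mean f_ij is exactly the
  -- integral of f over the pixel.
  refine ⟨D.angle q, D.abs_sub_angle_le hq hzq, fun x => ∑ i ∈ Finset.Icc 1 D.N,
    ∑ j ∈ Finset.Icc 1 D.M, (D.pixel i j).indicator 1 x * F i j, ?_, ?_, ?_⟩
  · simp only [Finset.sum_mul]
    exact integrable_finsetSum _ fun i _ => integrable_finsetSum _ fun j _ => hint i j
  · intro x hx
    obtain ⟨i, hi, j, hj, hij⟩ := D.exists_pixel hD hx
    exact ⟨D.pixelCenter i j, D.norm_pixelCenter_sub_le hij, D.sum_pixel_indicator_mul hi hj hij F⟩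
  · simp only [Finset.sum_mul]
    rw [integral_finsetSum _ fun i _ => integrable_finsetSum _ fun j _ => hint i j]
    simp only [integral_finsetSum _ fun j _ => hint _ j,
      integral_indicator_mul_mul (D.measurableSet_pixel _ _)]
    have e (p q : ℕ) : (D.detectorPixel R RE p).indicator (1 : ℝ → ℝ) z.1 *
        (D.angleCell q).indicator 1 z.2 =
        (D.detectorPixel R RE p ×ˢ D.angleCell q).indicator 1 z := by
      by_cases h1 : z.1 ∈ D.detectorPixel R RE p <;> by_cases h2 : z.2 ∈ D.angleCell q <;>
        simp [h1, h2, indicator, mem_prod]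
    rw [discreteTransform]
    simp only [e, mul_assoc]
    rw [D.sum_cell_indicator_mul hδ hp hq hzp hzq]
    simp only [Finset.mul_sum]
    refine Finset.sum_congr rfl fun i _ => Finset.sum_congr rfl fun j _ => ?_
    have := D.pixelSize_pos
    simp only [imageMean, F, c]
    field_simp

/-- The adjoint of the discrete transform as an integral operator. -/
lemma exists_discreteTransformAdjoint_eq (hδ : 0 < D.detectorSize R RE) (hD : D.Covers)
    {g : ℝ × ℝ → ℝ} (hg : Integrable g) {x : Plane} (hx : x ∈ imageDomain) :
    ∃ y, ‖y - x‖ ≤ D.pixelSize ∧ ∃ ψ : ℝ × ℝ → ℝ, Integrable (fun z => ψ z * g z) ∧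
      (∀ z ∈ sinogramDomain R RE, ∃ β, (∃ k : ℤ, |z.2 + 2 * Real.pi * k - β| ≤ D.angleWidth) ∧
        ψ z = hat (D.detectorSize R RE) (offset R RE y β -
          cellCenter (detectorWidth R RE / 2) (D.detectorSize R RE) z.1) / depth RE y β *
          √(cellCenter (detectorWidth R RE / 2) (D.detectorSize R RE) z.1 ^ 2 + R ^ 2)) ∧
      D.discreteTransformAdjoint R RE g x =
        1 / D.detectorSize R RE ^ 2 * ∫ z, ψ z * g z := by
  obtain ⟨i, hi, j, hj, hij⟩ := D.exists_pixel hD hx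
  let F : ℕ → ℕ → ℝ := fun p q =>
    hat (D.detectorSize R RE) (offset R RE (D.pixelCenter i j) (D.angle q) -
      D.detectorOffset R RE p) / depth RE (D.pixelCenter i j) (D.angle q) *
      √(D.detectorOffset R RE p ^ 2 + R ^ 2)
  have hm (p q : ℕ) : MeasurableSet (D.detectorPixel R RE p ×ˢ D.angleCell q) :=
    (D.measurableSet_detectorPixel p).prod (D.measurableSet_angleCell q)
  have hint (p q : ℕ) : Integrable fun z =>
      (D.detectorPixel R RE p ×ˢ D.angleCell q).indicator 1 z * F p q * g z :=
    integrable_indicator_mul_mul (hm p q) hg _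
  -- The kernel is constant on each cell, and Δ_q/δ_ξ times the normalization 1/(δ_ξ Δ_q) of the
  -- means leaves exactly 1/δ_ξ².
  refine ⟨D.pixelCenter i j, D.norm_pixelCenter_sub_le hij, fun z => ∑ p ∈ Finset.Icc 1 D.P,
    ∑ q ∈ Finset.Icc 1 D.Q, (D.detectorPixel R RE p ×ˢ D.angleCell q).indicator 1 z * F p q,
    ?_, ?_, ?_⟩
  · simp only [Finset.sum_mul]
    exact integrable_finsetSum _ fun p _ => integrable_finsetSum _ fun q _ => hint p q
  · intro z hz
    obtain ⟨p, hp, hzp⟩ := D.exists_detectorPixel hδ hz.1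
    obtain ⟨q, hq, hzq⟩ := D.exists_angleCell hz.2
    refine ⟨D.angle q, D.abs_sub_angle_le hq hzq, ?_⟩
    rw [← D.detectorOffset_eq_cellCenter hδ hzp]
    exact D.sum_cell_indicator_mul hδ hp hq hzp hzq F
  · simp only [Finset.sum_mul]
    rw [integral_finsetSum _ fun p _ => integrable_finsetSum _ fun q _ => hint p q]
    simp only [integral_finsetSum _ fun q _ => hint _ q, integral_indicator_mul_mul (hm _ _)]
    rw [discreteTransformAdjoint, D.sum_pixel_indicator_mul hi hj hij]
    simp only [Finset.mul_sum]
    rw [Finset.sum_comm]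
    refine Finset.sum_congr rfl fun p _ => Finset.sum_congr rfl fun q hq => ?_
    have := D.angleLength_pos hq
    simp only [sinogramMean, F]
    field_simp

end Grid

/-! ### The majorant and its L² norm -/

section Majorant

variable {G : ℝ × ℝ → ℝ≥0∞} {h : ℝ × ℝ → ℝ} {a b r δ : ℝ}

/-- The local averages which dominate the discretization errors. -/
noncomputable def majorant (G : ℝ × ℝ → ℝ≥0∞) (h : ℝ × ℝ → ℝ) (a b r δ : ℝ) (z : ℝ × ℝ) : ℝ≥0∞ :=
  ENNReal.ofReal a * (∫⁻ s in Icc (-r) r, G (z.1 + s, z.2)) +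
    ENNReal.ofReal b * ∫⁻ s in Icc (-(2 * δ)) (2 * δ), ‖h (z.1 + s, z.2) - h z‖ₑ

lemma measurable_average (hG : Measurable G) (r : ℝ) :
    Measurable fun z : ℝ × ℝ => ∫⁻ s in Icc (-r) r, G (z.1 + s, z.2) :=
  Measurable.lintegral_prod_right' (f := fun p : (ℝ × ℝ) × ℝ => G (p.1.1 + p.2, p.1.2))
    (by fun_prop)

lemma measurable_average_sub (hh : Measurable h) (r : ℝ) :
    Measurable fun z : ℝ × ℝ => ∫⁻ s in Icc (-r) r, ‖h (z.1 + s, z.2) - h z‖ₑ :=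
  Measurable.lintegral_prod_right'
    (f := fun p : (ℝ × ℝ) × ℝ => ‖h (p.1.1 + p.2, p.1.2) - h p.1‖ₑ) (by fun_prop)

lemma measurable_majorant (hG : Measurable G) (hh : Measurable h) :
    Measurable (majorant G h a b r δ) :=
  ((measurable_average hG r).const_mul _).add ((measurable_average_sub hh (2 * δ)).const_mul _)

lemma lintegral_majorant_sq_le (hG : Measurable G) (hh : Measurable h) (ha : 0 ≤ a) (hb : 0 ≤ b)
    (hr : 0 ≤ r) (hδ : 0 ≤ δ) :
    ∫⁻ z, majorant G h a b r δ z ^ 2 ∂cylinder ≤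
      ENNReal.ofReal (16 * (a * r) ^ 2) * ∫⁻ z, G z ^ 2 ∂cylinder +
        ENNReal.ofReal (256 * b ^ 2 * δ) * ∫⁻ s in Icc (-δ) δ, modulusSq h s := by
  have h1 := lintegral_sq_average_le hr hG
  have h2 := lintegral_sq_average_sub_le hh hδ
  have m1 := measurable_average hG r
  have m2 := measurable_average_sub hh (2 * δ)
  -- The factor 4 from here turns the constants 4r² and 64δ of `h1` and `h2` into 16 and 256.
  refine (lintegral_mono fun z => sq_add_le _ _).trans ?_
  simp only [mul_pow]
  rw [lintegral_const_mul _ (by fun_prop), lintegral_add_left (by fun_prop),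
    lintegral_const_mul _ (by fun_prop), lintegral_const_mul _ (by fun_prop)]
  refine (mul_le_mul' le_rfl
    (add_le_add (mul_le_mul' le_rfl h1) (mul_le_mul' le_rfl h2))).trans_eq ?_
  rw [mul_add, ← mul_assoc, ← mul_assoc, ← mul_assoc, ← mul_assoc, ← ENNReal.ofReal_pow ha,
    ← ENNReal.ofReal_pow hb, ← ENNReal.ofReal_ofNat 4, ← ENNReal.ofReal_mul (by positivity),
    ← ENNReal.ofReal_mul (by positivity), ← ENNReal.ofReal_mul (by positivity),
    ← ENNReal.ofReal_mul (by positivity)]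
  congr 3 <;> ring

end Majorant

/-- The square roots are the moduli of the complex numbers a + Ri and b + Ri, so this is the reverse
triangle inequality. -/
lemma abs_sqrt_sub_sqrt_le (a b R : ℝ) : |√(a ^ 2 + R ^ 2) - √(b ^ 2 + R ^ 2)| ≤ |a - b| := by
  rw [← Complex.norm_add_mul_I, ← Complex.norm_add_mul_I]
  refine (abs_norm_sub_norm_le _ _).trans_eq ?_
  rw [add_sub_add_right_eq_sub, ← Complex.ofReal_sub, Complex.norm_real, Real.norm_eq_abs]

lemma sqrt_sq_add_sq_le {a b R : ℝ} (hab : |a| ≤ b) (hR : 0 ≤ R) : √(a ^ 2 + R ^ 2) ≤ b + R := by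
  have hb := (abs_nonneg a).trans hab
  rw [Real.sqrt_le_left (by positivity)]
  nlinarith [sq_le_sq.2 (hab.trans (le_abs_self b)), mul_nonneg hb hR]

/-! ### Pointwise error of the discrete transform -/

section Forward

variable {R RE : ℝ} {f : Plane → ℝ}

lemma measurable_transform (hf : Measurable f) : Measurable (transform R RE f) := by
  unfold transform
  have h : Measurable fun z : ℝ × ℝ => ∫ t, f (rayPoint R RE z t) :=
    (StronglyMeasurable.integral_prod_right' (f := fun p : (ℝ × ℝ) × ℝ =>
      f (rayPoint R RE p.1 p.2)) (Measurable.stronglyMeasurable (by fun_prop))).measurable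
  unfold rayPoint at h
  fun_prop

lemma transform_eq (z : ℝ × ℝ) :
    transform R RE f z = √(z.1 ^ 2 + R ^ 2) * ∫ t, f (rayPoint R RE z t) := rfl

lemma enorm_integral_ray_le (z : ℝ × ℝ) :
    ‖∫ t, f (rayPoint R RE z t)‖ₑ ≤ rayNorm R RE f z := enorm_integral_le_lintegral_enorm _

/-- In fanbeam coordinates the strip is a window of detector positions around ξ, and the Jacobian is
at most RE + 1 where f does not vanish. -/
lemma setLIntegral_strip_le (hRE : 1 < RE) (hR : 0 < R) (hf : Measurable f)
    (hf0 : ∀ x, x ∉ imageDomain → f x = 0) (r ξ α : ℝ) :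
    ∫⁻ x in {x | |offset R RE x α - ξ| ≤ r}, ‖f x‖ₑ ≤
      ENNReal.ofReal (RE + 1) * ∫⁻ s in Icc (-r) r, rayNorm R RE f (ξ + s, α) := by
  have ho : Measurable fun x : Plane => offset R RE x α := by
    unfold offset depth; fun_prop
  have hs : MeasurableSet {x : Plane | |offset R RE x α - ξ| ≤ r} :=
    measurableSet_le (by fun_prop) measurable_const
  have hm : Measurable fun p : ℝ × ℝ => rayPoint R RE (p.1, α) p.2 :=
    ((continuous_rayPoint R RE).comp
      (by fun_prop : Continuous fun p : ℝ × ℝ => ((p.1, α), p.2))).measurable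
  have hi : Measurable ({x : Plane | |offset R RE x α - ξ| ≤ r}.indicator fun x => ‖f x‖ₑ) :=
    hf.enorm.indicator hs
  have hn := measurable_rayNorm (R := R) (RE := RE) hf
  rw [← lintegral_indicator hs, lintegral_plane_eq hR.ne' RE α hi, Measure.volume_eq_prod,
    lintegral_prod _ (by fun_prop), ← lintegral_add_left_eq_self _ ξ,
    ← lintegral_indicator measurableSet_Icc, ← lintegral_const_mul _
      (Measurable.indicator (by fun_prop) measurableSet_Icc)]
  refine lintegral_mono fun s => ?_
  have key (t : ℝ) : ENNReal.ofReal |t * R| *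
      {x : Plane | |offset R RE x α - ξ| ≤ r}.indicator (fun x => ‖f x‖ₑ)
        (rayPoint R RE (ξ + s, α) t) ≤
      (Icc (-r) r).indicator (fun _ => ENNReal.ofReal (RE + 1)) s *
        ‖f (rayPoint R RE (ξ + s, α) t)‖ₑ := by
    by_cases h : rayPoint R RE (ξ + s, α) t ∈ imageDomain
    · have ht := mem_Icc_of_rayPoint_mem hR h
      have h1 := abs_lt.1 (abs_lt_of_rayPoint_mem h).1
      have ht0 : 0 < t := lt_of_lt_of_le (div_pos (by linarith) hR) ht.1
      have e := offset_rayPoint hR.ne' RE (ξ + s, α) ht0.ne'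
      by_cases hs : s ∈ Icc (-r) r
      · rw [indicator_of_mem hs, abs_of_pos (by positivity)]
        gcongr
        · linarith [h1.2]
        · exact indicator_le_self _ _ _
      · rw [indicator_of_notMem, mul_zero]
        · exact zero_le
        · rw [mem_ofPred_eq, e]
          contrapose! hs
          simpa [abs_le] using hs
    · simp [indicator, hf0 _ h]
  refine (lintegral_mono key).trans_eq ?_
  rw [lintegral_const_mul]
  · by_cases hs : s ∈ Icc (-r) r
    · rw [indicator_of_mem hs, indicator_of_mem hs]; rfl
    · rw [indicator_of_notMem hs, indicator_of_notMem hs]; simp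
  · have : Measurable fun t : ℝ => rayPoint R RE (ξ + s, α) t :=
      hm.comp (by fun_prop : Measurable fun t : ℝ => (ξ + s, t))
    exact (hf.comp this).enorm

lemma integrable_hat_div_depth (hRE : 1 < RE) (hf : Integrable f)
    (hf0 : ∀ x, x ∉ imageDomain → f x = 0) {δ : ℝ} (hδ : 0 < δ) (c α : ℝ) :
    Integrable fun x => Grid.hat δ (offset R RE x α - c) / depth RE x α * f x := by
  have hm : 0 < RE - 1 := by linarith
  have hk : Measurable fun x => Grid.hat δ (offset R RE x α - c) / depth RE x α := by
    have h1 : Measurable fun x : Plane => depth RE x α := by unfold depth; fun_prop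
    have h2 : Measurable fun x : Plane => offset R RE x α := by unfold offset depth; fun_prop
    exact ((continuous_hat δ).measurable.comp (h2.sub_const c)).div h1
  refine (hf.norm.const_mul (δ / (RE - 1))).mono'
    (hk.aestronglyMeasurable.mul hf.aestronglyMeasurable) (ae_of_all _ fun x => ?_)
  by_cases hx : x ∈ imageDomain
  · have hd := (depth_mem_Ioo (RE := RE) hx α).1
    rw [norm_mul, norm_div, Real.norm_of_nonneg (hat_nonneg _ _),
      Real.norm_of_nonneg (hm.le.trans hd.le)]
    gcongr
    exact hat_le hδ.le _
  · simp [hf0 x hx]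

/-- Along a ray the depth is tR, which is positive on the disc, so it cancels the Jacobian |tR|. -/
lemma integrable_hat_mul_ray (hRE : 1 < RE) (hR : 0 < R) (hf : Integrable f)
    (hf0 : ∀ x, x ∉ imageDomain → f x = 0) {δ : ℝ} (hδ : 0 < δ) (c α : ℝ) :
    Integrable (fun p : ℝ × ℝ => Grid.hat δ (p.1 - c) * f (rayPoint R RE (p.1, α) p.2)) ∧
    ∫ x, Grid.hat δ (offset R RE x α - c) / depth RE x α * f x =
      ∫ p : ℝ × ℝ, Grid.hat δ (p.1 - c) * f (rayPoint R RE (p.1, α) p.2) := by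
  have hi := integrable_hat_div_depth (R := R) hRE hf hf0 hδ c α
  have e : (fun p : ℝ × ℝ => |p.2 * R| * (Grid.hat δ (offset R RE (rayPoint R RE (p.1, α) p.2) α - c) /
      depth RE (rayPoint R RE (p.1, α) p.2) α * f (rayPoint R RE (p.1, α) p.2))) =
      fun p => Grid.hat δ (p.1 - c) * f (rayPoint R RE (p.1, α) p.2) := by
    ext ⟨ξ, t⟩
    by_cases h : rayPoint R RE (ξ, α) t ∈ imageDomain
    · have ht := mem_Icc_of_rayPoint_mem hR h
      have ht0 : 0 < t := lt_of_lt_of_le (div_pos (by linarith) hR) ht.1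
      have e1 := offset_rayPoint hR.ne' RE (ξ, α) ht0.ne'
      have e2 := depth_rayPoint R RE (ξ, α) t
      simp only at e1 e2 ⊢
      rw [e1, e2, abs_of_pos (by positivity)]
      field_simp
    · simp [hf0 _ h]
  have h1 := integrable_rayPoint hR.ne' RE α hi
  have h2 := integral_plane_eq hR.ne' RE α hi
  rw [e] at h1 h2
  exact ⟨h1, h2⟩

/-- The error of the semi-discretization in the detector variable. -/
lemma enorm_semidiscrete_sub_le (hRE : 1 < RE) (hR : 0 < R) (hf : Integrable f)
    (hf0 : ∀ x, x ∉ imageDomain → f x = 0) {δ : ℝ} (hδ : 0 < δ) {z : ℝ × ℝ} {c : ℝ}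
    (hc : |z.1 - c| ≤ δ / 2) :
    ‖1 / δ ^ 2 * √(c ^ 2 + R ^ 2) *
        (∫ x, Grid.hat δ (offset R RE x z.2 - c) / depth RE x z.2 * f x) - transform R RE f z‖ₑ ≤
      ∫⁻ s in Icc (-(2 * δ)) (2 * δ), (ENNReal.ofReal (1 / δ) *
        ‖transform R RE f (z.1 + s, z.2) - transform R RE f z‖ₑ +
          rayNorm R RE f (z.1 + s, z.2)) := by
  obtain ⟨h1, h2⟩ := integrable_hat_mul_ray hRE hR hf hf0 hδ c z.2
  set A : ℝ → ℝ := fun ξ => ∫ t, f (rayPoint R RE (ξ, z.2) t) with hA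
  rw [Measure.volume_eq_prod] at h1 h2
  have h3 := h1.integral_prod_left
  simp only [integral_const_mul] at h3
  change Integrable (fun ξ => Grid.hat δ (ξ - c) * A ξ) at h3
  have hhat : Integrable fun ξ => Grid.hat δ (ξ - c) := by
    refine Integrable.of_integral_ne_zero ?_
    rw [integral_hat_sub hδ]; positivity
  rw [h2, integral_prod _ h1]
  simp only [integral_const_mul]
  -- The hat has integral δ², so the constant `transform R RE f z` can be moved under the integral.
  have e : 1 / δ ^ 2 * √(c ^ 2 + R ^ 2) * (∫ ξ, Grid.hat δ (ξ - c) * A ξ) - transform R RE f z =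
      ∫ ξ, 1 / δ ^ 2 * (Grid.hat δ (ξ - c) * (√(c ^ 2 + R ^ 2) * A ξ - transform R RE f z)) := by
    have e1 (ξ : ℝ) : Grid.hat δ (ξ - c) * (√(c ^ 2 + R ^ 2) * A ξ - transform R RE f z) =
        √(c ^ 2 + R ^ 2) * (Grid.hat δ (ξ - c) * A ξ) -
          Grid.hat δ (ξ - c) * transform R RE f z := by ring
    simp only [e1]
    rw [integral_const_mul, integral_sub (h3.const_mul _) (hhat.mul_const _), integral_const_mul,
      integral_mul_const, integral_hat_sub hδ]
    field_simp
  rw [e]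
  refine (enorm_integral_le_lintegral_enorm _).trans ?_
  rw [← lintegral_add_left_eq_self _ z.1, ← lintegral_indicator measurableSet_Icc]
  refine lintegral_mono fun s => ?_
  by_cases hs : δ ≤ |z.1 + s - c|
  · simp [hat_eq_zero hs]
  have hs' := abs_lt.1 (not_le.1 hs)
  have hc' := abs_le.1 hc
  -- On the support of the hat |s| < δ + δ/2, which lies within the window of radius 2δ.
  rw [indicator_of_mem (by constructor <;> linarith [hs'.1, hs'.2, hc'.1, hc'.2])]
  -- Exchanging the frozen weight for the true one costs at most δ, which cancels the bound 1/δ of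
  -- the normalized hat and leaves one copy of `rayNorm`.
  have e2 : √(c ^ 2 + R ^ 2) * A (z.1 + s) - transform R RE f z =
      (transform R RE f (z.1 + s, z.2) - transform R RE f z) +
        (√(c ^ 2 + R ^ 2) - √((z.1 + s) ^ 2 + R ^ 2)) * A (z.1 + s) := by
    rw [transform_eq (z.1 + s, z.2)]; simp only [hA]; ring
  have hk : ‖1 / δ ^ 2 * Grid.hat δ (z.1 + s - c)‖ₑ ≤ ENNReal.ofReal (1 / δ) := by
    rw [Real.enorm_of_nonneg (mul_nonneg (by positivity) (hat_nonneg _ _))]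
    refine ENNReal.ofReal_le_ofReal ?_
    rw [show 1 / δ = 1 / δ ^ 2 * δ by field_simp]
    gcongr
    exact hat_le hδ.le _
  have hq : ‖√(c ^ 2 + R ^ 2) - √((z.1 + s) ^ 2 + R ^ 2)‖ₑ ≤ ENNReal.ofReal δ := by
    rw [Real.enorm_eq_ofReal_abs]
    refine ENNReal.ofReal_le_ofReal ((abs_sqrt_sub_sqrt_le _ _ _).trans ?_)
    rw [abs_sub_comm]; exact (not_le.1 hs).le
  simp only
  rw [← mul_assoc, enorm_mul, e2]
  refine (mul_le_mul' hk (enorm_add_le _ _)).trans ?_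
  rw [mul_add, enorm_mul]
  gcongr
  calc _ ≤ ENNReal.ofReal (1 / δ) * (ENNReal.ofReal δ * rayNorm R RE f (z.1 + s, z.2)) := by
        gcongr
        exact enorm_integral_ray_le _
    _ = _ := by
        rw [← mul_assoc, ← ENNReal.ofReal_mul (by positivity), one_div_mul_cancel hδ.ne']
        simp

/-- A bound for `√(c² + R²)` at the centers `c` of detector pixels. -/
noncomputable def weightBound (R RE : ℝ) : ℝ := detectorWidth R RE / 2 + 1 + R

lemma sqrt_cellCenter_le (hR : 0 < R) {δ : ℝ} (hδ : 0 < δ) (hδ1 : δ ≤ 1) {z : ℝ × ℝ}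
    (hz : z ∈ sinogramDomain R RE) :
    √(cellCenter (detectorWidth R RE / 2) δ z.1 ^ 2 + R ^ 2) ≤ weightBound R RE := by
  refine sqrt_sq_add_sq_le ?_ hR.le
  have h := abs_le.1 (abs_sub_cellCenter_le hδ (detectorWidth R RE / 2) z.1)
  have h1 := hz.1
  rw [mem_Ioo] at h1
  rw [abs_le]
  constructor <;> linarith [h.1, h.2, h1.1, h1.2]

lemma weightBound_nonneg (hRE : 1 < RE) (hR : 0 < R) : 0 ≤ weightBound R RE := by
  have := Grid.detectorWidth_pos hRE hR
  unfold weightBound; positivity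

/-- Pointwise bound for the error of the discrete transform. -/
lemma enorm_discreteTransform_sub_le (hRE : 1 < RE) (hR : 0 < R) (hf : Measurable f)
    (hfi : Integrable f) (hf0 : ∀ x, x ∉ imageDomain → f x = 0) (D : Grid) (hD : D.Covers)
    (hδ1 : D.detectorSize R RE ≤ 1) {η r : ℝ} (hx : D.pixelSize ≤ η) (hα : D.angleWidth ≤ η)
    (hη : 6 * η ≤ RE - 1) (hr : 2 * D.detectorSize R RE + offsetLip R RE * η ≤ r) {z : ℝ × ℝ}
    (hz : z ∈ sinogramDomain R RE) :
    ‖D.discreteTransform R RE f z - transform R RE f z‖ₑ ≤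
      majorant (rayNorm R RE f) (transform R RE f)
        (weightBound R RE * kernelLip R RE * (RE + 1) * (η / D.detectorSize R RE ^ 2) + 1)
        (1 / D.detectorSize R RE) r (D.detectorSize R RE) z := by
  have hδ := D.detectorSize_pos hRE hR
  obtain ⟨β, ⟨k, hk⟩, φ, hφi, hφ, hD⟩ := D.exists_discreteTransform_eq hδ hD hfi hz
  have hB := sqrt_cellCenter_le hR hδ hδ1 hz
  have hc := abs_sub_cellCenter_le hδ (detectorWidth R RE / 2) z.1
  set δ := D.detectorSize R RE
  set c := cellCenter (detectorWidth R RE / 2) δ z.1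
  have hη0 : 0 ≤ η := D.pixelSize_pos.le.trans hx
  have hL := mul_nonneg (offsetLip_nonneg hRE hR) hη0
  have hB0 := weightBound_nonneg hRE hR
  have hK0 := kernelLip_nonneg hRE hR
  have hi := integrable_hat_div_depth (R := R) hRE hfi hf0 hδ c z.2
  set φ' : Plane → ℝ := fun x => Grid.hat δ (offset R RE x z.2 - c) / depth RE x z.2 with hφ'
  -- Kernel error plus semi-discretization error; φ' is the kernel at the exact x and angle, with
  -- the detector position still frozen at c.
  have e : D.discreteTransform R RE f z - transform R RE f z =
      1 / δ ^ 2 * √(c ^ 2 + R ^ 2) * (∫ x, (φ x * f x - φ' x * f x)) +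
        (1 / δ ^ 2 * √(c ^ 2 + R ^ 2) * (∫ x, φ' x * f x) - transform R RE f z) := by
    rw [hD, integral_sub hφi hi]; ring
  have ho : Measurable fun x : Plane => offset R RE x z.2 := by
    unfold offset depth; fun_prop
  have hs : MeasurableSet {x : Plane | |offset R RE x z.2 - z.1| ≤ r} :=
    measurableSet_le (by fun_prop) measurable_const
  have b1 : ‖∫ x, (φ x * f x - φ' x * f x)‖ₑ ≤ ENNReal.ofReal (kernelLip R RE * η) *
      (ENNReal.ofReal (RE + 1) * ∫⁻ s in Icc (-r) r, rayNorm R RE f (z.1 + s, z.2)) := by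
    refine (enorm_integral_le_lintegral_enorm _).trans (le_trans ?_
      (mul_le_mul' le_rfl (setLIntegral_strip_le hRE hR hf hf0 r z.1 z.2)))
    rw [← lintegral_indicator hs, ← lintegral_const_mul _ (hf.enorm.indicator hs)]
    refine lintegral_mono fun x => ?_
    simp only
    by_cases hxΩ : x ∈ imageDomain
    · obtain ⟨y, hy, hφx⟩ := hφ x hxΩ
      rw [← sub_mul, enorm_mul, hφx]
      by_cases hm : |offset R RE x z.2 - z.1| ≤ r
      · rw [indicator_of_mem (by exact hm)]
        gcongr
        rw [Real.enorm_eq_ofReal_abs]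
        exact ENNReal.ofReal_le_ofReal (abs_kernel_sub_le hRE hR hxΩ (hy.trans hx)
          ⟨k, hk.trans hα⟩ hη hδ hδ1 c)
      -- Off the strip, |Ξ - c| exceeds r - δ/2 ≥ δ + Lη with L = `offsetLip R RE`, so both kernels
      -- vanish.
      · simp only [hφ']
        rw [kernel_sub_eq_zero hRE hR hxΩ (hy.trans hx) ⟨k, hk.trans hα⟩ hη]
        · simp
        · have := abs_sub_le (offset R RE x z.2) c z.1
          rw [abs_sub_comm c z.1] at this
          linarith
    · simp [hf0 x hxΩ]
  have b2 := enorm_semidiscrete_sub_le hRE hR hfi hf0 hδ hc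
  rw [e]
  refine (enorm_add_le _ _).trans ?_
  rw [enorm_mul, majorant, ENNReal.ofReal_add (by positivity) zero_le_one, ENNReal.ofReal_one,
    add_mul, one_mul, add_assoc]
  refine add_le_add ?_ (b2.trans ?_)
  · have b0 : ‖1 / δ ^ 2 * √(c ^ 2 + R ^ 2)‖ₑ ≤
        ENNReal.ofReal (1 / δ ^ 2 * weightBound R RE) := by
      rw [Real.enorm_of_nonneg (by positivity)]
      gcongr
    refine (mul_le_mul' b0 b1).trans_eq ?_
    rw [← mul_assoc, ← mul_assoc, ← ENNReal.ofReal_mul (by positivity),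
      ← ENNReal.ofReal_mul (by positivity)]
    congr 2; ring
  · have m1 := measurable_rayNorm (R := R) (RE := RE) hf
    have m2 := measurable_transform (R := R) (RE := RE) hf
    rw [lintegral_add_right _ (by fun_prop), lintegral_const_mul _ (by fun_prop), add_comm]
    exact add_le_add (lintegral_mono_set (Icc_subset_Icc (by linarith) (by linarith))) le_rfl

end Forward

/-! ### Pointwise error of the discrete adjoint -/

section Adjoint

variable {R RE : ℝ} {g : ℝ × ℝ → ℝ}

lemma measurable_transformAdjoint (hg : Measurable g) :
    Measurable (transformAdjoint R RE g) := by
  unfold transformAdjoint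
  have ho : Measurable fun p : Plane × ℝ => offset R RE p.1 p.2 := by fun_prop
  have hd : Measurable fun p : Plane × ℝ => depth RE p.1 p.2 := by fun_prop
  have hp : Measurable fun p : Plane × ℝ => g (offset R RE p.1 p.2, p.2) :=
    hg.comp (ho.prodMk measurable_snd)
  exact (StronglyMeasurable.integral_prod_right' (ν := volume.restrict circle)
    (f := fun p : Plane × ℝ => √(offset R RE p.1 p.2 ^ 2 + R ^ 2) * (1 / depth RE p.1 p.2) *
      g (offset R RE p.1 p.2, p.2)) (Measurable.stronglyMeasurable (by fun_prop))).measurable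

/-- A bound for `√(Ξ(x, α)² + R²)`. -/
noncomputable def offsetWeightBound (R RE : ℝ) : ℝ := R / (RE - 1) + R

lemma offsetWeightBound_nonneg (hRE : 1 < RE) (hR : 0 < R) : 0 ≤ offsetWeightBound R RE := by
  have : 0 < RE - 1 := by linarith
  unfold offsetWeightBound; positivity

lemma sqrt_offset_le (hRE : 1 < RE) (hR : 0 < R) {x : Plane} (hx : x ∈ imageDomain) (α : ℝ) :
    √(offset R RE x α ^ 2 + R ^ 2) ≤ offsetWeightBound R RE :=
  sqrt_sq_add_sq_le (abs_offset_le hRE hR hx α) hR.le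

lemma abs_adjointWeight_le (hRE : 1 < RE) (hR : 0 < R) {x : Plane} (hx : x ∈ imageDomain)
    (α : ℝ) : |√(offset R RE x α ^ 2 + R ^ 2) * (1 / depth RE x α)| ≤
      offsetWeightBound R RE / (RE - 1) := by
  have hm : 0 < RE - 1 := by linarith
  have hd := (depth_mem_Ioo (RE := RE) hx α).1
  have hd0 := hm.trans hd
  have := sqrt_offset_le hRE hR hx α
  have := offsetWeightBound_nonneg hRE hR
  rw [abs_of_nonneg (by positivity), mul_one_div]
  gcongr

lemma measurable_adjointIntegrand (hg : Measurable g) (x : Plane) :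
    Measurable fun α => √(offset R RE x α ^ 2 + R ^ 2) * (1 / depth RE x α) *
      g (offset R RE x α, α) := by
  have hd : Measurable fun α : ℝ => depth RE x α := by unfold depth; fun_prop
  have ho : Measurable fun α : ℝ => offset R RE x α := by unfold offset depth; fun_prop
  have hp : Measurable fun α : ℝ => g (offset R RE x α, α) := hg.comp (ho.prodMk measurable_id)
  fun_prop

lemma integrable_hat_sub_cellCenter {δ : ℝ} (hδ : 0 < δ) (w y : ℝ) :
    Integrable fun ξ => Grid.hat δ (y - cellCenter w δ ξ) := by
  refine Integrable.of_integral_ne_zero ?_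
  rw [integral_hat_sub_cellCenter hδ]; positivity

/-- The backprojection as an integral over the cylinder. -/
lemma integrable_hat_mul_adjoint (hRE : 1 < RE) (hR : 0 < R) (hg : Measurable g) {x : Plane}
    (hx : x ∈ imageDomain) (hfin : ∫⁻ α in circle, ‖g (offset R RE x α, α)‖ₑ ≠ ∞) {δ : ℝ}
    (hδ : 0 < δ) (w : ℝ) :
    Integrable (fun z : ℝ × ℝ => Grid.hat δ (offset R RE x z.2 - cellCenter w δ z.1) *
      (√(offset R RE x z.2 ^ 2 + R ^ 2) * (1 / depth RE x z.2) * g (offset R RE x z.2, z.2)))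
      cylinder ∧
    ∫ z, Grid.hat δ (offset R RE x z.2 - cellCenter w δ z.1) *
      (√(offset R RE x z.2 ^ 2 + R ^ 2) * (1 / depth RE x z.2) * g (offset R RE x z.2, z.2))
      ∂cylinder = δ ^ 2 * transformAdjoint R RE g x := by
  have ho : Measurable fun α : ℝ => offset R RE x α := by unfold offset depth; fun_prop
  have hp : Measurable fun α : ℝ => g (offset R RE x α, α) := hg.comp (ho.prodMk measurable_id)
  have hq := measurable_adjointIntegrand (R := R) (RE := RE) hg x
  set q : ℝ → ℝ := fun α => √(offset R RE x α ^ 2 + R ^ 2) * (1 / depth RE x α) *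
    g (offset R RE x α, α) with hqdef
  have hgi : Integrable (fun α => g (offset R RE x α, α)) (volume.restrict circle) :=
    ⟨hp.aestronglyMeasurable, hfin.lt_top⟩
  have hqi : Integrable q (volume.restrict circle) := by
    refine (hgi.norm.const_mul (offsetWeightBound R RE / (RE - 1))).mono'
      hq.aestronglyMeasurable (ae_of_all _ fun α => ?_)
    rw [hqdef, norm_mul]
    exact mul_le_mul_of_nonneg_right (abs_adjointWeight_le hRE hR hx α) (norm_nonneg _)
  have hT : ∫ α in circle, q α = transformAdjoint R RE g x := rfl
  change Integrable (fun z : ℝ × ℝ =>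
      Grid.hat δ (offset R RE x z.2 - cellCenter w δ z.1) * q z.2) cylinder ∧
    ∫ z, Grid.hat δ (offset R RE x z.2 - cellCenter w δ z.1) * q z.2 ∂cylinder =
      δ ^ 2 * transformAdjoint R RE g x
  clear_value q
  have hm : Measurable fun z : ℝ × ℝ =>
      Grid.hat δ (offset R RE x z.2 - cellCenter w δ z.1) * q z.2 := by fun_prop
  have hnorm (ξ α : ℝ) : ‖Grid.hat δ (offset R RE x α - cellCenter w δ ξ) * q α‖ =
      Grid.hat δ (offset R RE x α - cellCenter w δ ξ) * ‖q α‖ := by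
    rw [norm_mul, Real.norm_of_nonneg (hat_nonneg _ _)]
  have hi : Integrable (fun z : ℝ × ℝ =>
      Grid.hat δ (offset R RE x z.2 - cellCenter w δ z.1) * q z.2) cylinder := by
    -- Integrating in ξ first, the partition of unity gives δ² whatever the offset is, and an
    -- integral over the angle remains.
    refine (integrable_prod_iff' hm.aestronglyMeasurable).2
      ⟨ae_of_all _ fun α =>
        (integrable_hat_sub_cellCenter hδ w (offset R RE x α)).mul_const (q α), ?_⟩
    simp only [hnorm, integral_mul_const, integral_hat_sub_cellCenter hδ]
    exact hqi.norm.const_mul _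
  refine ⟨hi, ?_⟩
  refine (integral_prod_symm _ hi).trans ?_
  simp only [integral_mul_const, integral_hat_sub_cellCenter hδ, integral_const_mul, hT]

/-- Pointwise bound for the integrand of the error of the discrete adjoint. -/
lemma abs_adjoint_integrand_le {h₁ h₂ S₁ S₂ u v κ B δ m E : ℝ} (hδ : 0 < δ) (hm : 0 < m)
    (h12 : |h₁ - h₂| ≤ κ) (hh₂ : 0 ≤ h₂) (hh₂' : h₂ ≤ δ / m) (hS₁ : 0 ≤ S₁) (hS₁B : S₁ ≤ B)
    (hS₂ : 0 ≤ S₂) (hS₂E : S₂ ≤ E) (hS : |S₁ - S₂| ≤ δ) :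
    1 / δ ^ 2 * |h₁ * S₁ * u - h₂ * S₂ * v| ≤
      (B * κ / δ ^ 2 + 1 / m) * |u| + E / m * (1 / δ) * |u - v| := by
  -- Kernel, weight and function value are exchanged one at a time. In this order the first two
  -- errors carry |u|, and the last carries |u - v| with the exact kernel and weight.
  have e : h₁ * S₁ * u - h₂ * S₂ * v =
      (h₁ - h₂) * S₁ * u + (h₂ * (S₁ - S₂) * u + h₂ * S₂ * (u - v)) := by ring
  have hκ := (abs_nonneg _).trans h12
  have hB := hS₁.trans hS₁B
  have hE := hS₂.trans hS₂E
  have b1 : |(h₁ - h₂) * S₁ * u| ≤ κ * B * |u| := by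
    rw [abs_mul, abs_mul, abs_of_nonneg hS₁]; gcongr
  have b2 : |h₂ * (S₁ - S₂) * u| ≤ δ / m * δ * |u| := by
    rw [abs_mul, abs_mul, abs_of_nonneg hh₂]; gcongr
  have b3 : |h₂ * S₂ * (u - v)| ≤ δ / m * E * |u - v| := by
    rw [abs_mul, abs_mul, abs_of_nonneg hh₂, abs_of_nonneg hS₂]; gcongr
  have b := ((abs_add_le _ _).trans (add_le_add b1 ((abs_add_le _ _).trans (add_le_add b2 b3))))
  rw [e]
  calc _ ≤ 1 / δ ^ 2 * (κ * B * |u| + (δ / m * δ * |u| + δ / m * E * |u - v|)) := by gcongr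
    _ = _ := by field_simp; ring

/-- Pointwise bound for the error of the adjoint of the discrete transform. -/
lemma enorm_discreteTransformAdjoint_sub_le (hRE : 1 < RE) (hR : 0 < R) (hg : Measurable g)
    (hgi : Integrable g) (hg0 : ∀ z, z ∉ sinogramDomain R RE → g z = 0) (D : Grid)
    (hD : D.Covers) (hδ1 : D.detectorSize R RE ≤ 1) {η r : ℝ} (hxη : D.pixelSize ≤ η)
    (hα : D.angleWidth ≤ η) (hη : 6 * η ≤ RE - 1)
    (hr : 2 * D.detectorSize R RE + offsetLip R RE * η ≤ r) {x : Plane} (hx : x ∈ imageDomain)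
    (hfin : ∫⁻ α in circle, ‖g (offset R RE x α, α)‖ₑ ≠ ∞) :
    ‖D.discreteTransformAdjoint R RE g x - transformAdjoint R RE g x‖ₑ ≤
      ∫⁻ α in circle, majorant (fun z => ‖g z‖ₑ) g
        (weightBound R RE * (kernelLip R RE * η) / D.detectorSize R RE ^ 2 + 1 / (RE - 1))
        (offsetWeightBound R RE / (RE - 1) * (1 / D.detectorSize R RE)) r (D.detectorSize R RE)
        (offset R RE x α, α) := by
  have hm : 0 < RE - 1 := by linarith
  have hδ := D.detectorSize_pos hRE hR
  obtain ⟨y, hy, ψ, hψi, hψ, hD⟩ := D.exists_discreteTransformAdjoint_eq hδ hD hgi hx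
  have hB (z : ℝ × ℝ) (hz : z ∈ sinogramDomain R RE) := sqrt_cellCenter_le hR hδ hδ1 hz
  set δ := D.detectorSize R RE
  set w := detectorWidth R RE / 2
  obtain ⟨hFi, hF⟩ := integrable_hat_mul_adjoint hRE hR hg hx hfin hδ w
  set F : ℝ × ℝ → ℝ := fun z => Grid.hat δ (offset R RE x z.2 - cellCenter w δ z.1) *
    (√(offset R RE x z.2 ^ 2 + R ^ 2) * (1 / depth RE x z.2) * g (offset R RE x z.2, z.2)) with hFdef
  set a := weightBound R RE * (kernelLip R RE * η) / δ ^ 2 + 1 / (RE - 1) with ha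
  set b := offsetWeightBound R RE / (RE - 1) * (1 / δ) with hb
  have hη0 : 0 ≤ η := D.pixelSize_pos.le.trans hxη
  have hL := mul_nonneg (offsetLip_nonneg hRE hR) hη0
  have hB0 := weightBound_nonneg hRE hR
  have hE0 := offsetWeightBound_nonneg hRE hR
  have hK0 := mul_nonneg (kernelLip_nonneg hRE hR) hη0
  have ho : Measurable fun α : ℝ => offset R RE x α := by unfold offset depth; fun_prop
  have hψi' : Integrable (fun z => ψ z * g z) cylinder := by
    rw [cylinder_eq]; exact hψi.restrict
  have hψc : ∫ z, ψ z * g z = ∫ z, ψ z * g z ∂cylinder := by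
    rw [cylinder_eq, setIntegral_eq_integral_of_forall_compl_eq_zero]
    intro z hz
    rw [hg0 z fun h => hz ⟨mem_univ _, h.2⟩, mul_zero]
  have e : D.discreteTransformAdjoint R RE g x - transformAdjoint R RE g x =
      ∫ z, 1 / δ ^ 2 * (ψ z * g z - F z) ∂cylinder := by
    rw [integral_const_mul, integral_sub hψi' hFi, hF, hD, hψc]
    field_simp
  let A (ρ : ℝ) : Set (ℝ × ℝ) := {z | |z.1 - offset R RE x z.2| ≤ ρ}
  have hA (ρ : ℝ) : MeasurableSet (A ρ) := measurableSet_le (by fun_prop) measurable_const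
  -- The first term pays for kernel and weight, the second for the change of g. Integrated over ξ at
  -- fixed α, it is the majorant at (Ξ(x, α), α).
  let K : ℝ × ℝ → ℝ≥0∞ := fun z => (A r).indicator (fun z => ENNReal.ofReal a * ‖g z‖ₑ) z +
    (A (2 * δ)).indicator (fun z => ENNReal.ofReal b * ‖g z - g (offset R RE x z.2, z.2)‖ₑ) z
  have hgo : Measurable fun z : ℝ × ℝ => g (offset R RE x z.2, z.2) :=
    hg.comp ((ho.comp measurable_snd).prodMk measurable_snd)
  have hK : Measurable K :=
    (Measurable.indicator (by fun_prop) (hA _)).add (Measurable.indicator (by fun_prop) (hA _))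
  have key (z : ℝ × ℝ) (hz : z.2 ∈ circle) : ‖1 / δ ^ 2 * (ψ z * g z - F z)‖ₑ ≤ K z := by
    set c := cellCenter w δ z.1 with hc
    have hzc := abs_sub_cellCenter_le hδ w z.1
    rw [← hc] at hzc
    have hd := (depth_mem_Ioo (RE := RE) hx z.2).1
    set h₂ := Grid.hat δ (offset R RE x z.2 - c) / depth RE x z.2 with hh₂
    have hh₂0 : 0 ≤ h₂ := div_nonneg (hat_nonneg _ _) (hm.trans hd).le
    have hh₂m : h₂ ≤ δ / (RE - 1) := div_le_div₀ hδ.le (hat_le hδ.le _) hm hd.le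
    have htri : |z.1 - offset R RE x z.2| ≤ δ / 2 + |offset R RE x z.2 - c| := by
      have := abs_sub_le z.1 c (offset R RE x z.2)
      rw [abs_sub_comm c] at this
      linarith
    -- Outside the sinogram domain g z = 0, so h₁ may be chosen equal to h₂.
    have hex : ∃ h₁, ψ z * g z = h₁ * √(c ^ 2 + R ^ 2) * g z ∧ |h₁ - h₂| ≤ kernelLip R RE * η ∧
        (δ + offsetLip R RE * η ≤ |offset R RE x z.2 - c| → h₁ = h₂) := by
      by_cases hzd : z ∈ sinogramDomain R RE
      · obtain ⟨β, ⟨k, hk⟩, hψz⟩ := hψ z hzd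
        refine ⟨_, by rw [hψz], abs_kernel_sub_le hRE hR hx (hy.trans hxη) ⟨k, hk.trans hα⟩ hη hδ
          hδ1 c, fun h => ?_⟩
        exact sub_eq_zero.1
          (kernel_sub_eq_zero hRE hR hx (hy.trans hxη) ⟨k, hk.trans hα⟩ hη c h)
      · exact ⟨h₂, by simp [hg0 z hzd], by simpa using hK0, fun _ => rfl⟩
    obtain ⟨h₁, he, h12, h0⟩ := hex
    have eF : F z = h₂ * √(offset R RE x z.2 ^ 2 + R ^ 2) * g (offset R RE x z.2, z.2) := by
      simp only [hFdef, hh₂]; ring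
    rw [he, eF, Real.enorm_eq_ofReal_abs, abs_mul, abs_of_nonneg (by positivity : 0 ≤ 1 / δ ^ 2)]
    by_cases hs : |offset R RE x z.2 - c| < δ
    · have hz1 : z ∈ A r := by
        change |z.1 - offset R RE x z.2| ≤ r
        linarith
      have hz2 : z ∈ A (2 * δ) := by
        change |z.1 - offset R RE x z.2| ≤ 2 * δ
        linarith
      simp only [K, indicator_of_mem hz1, indicator_of_mem hz2, Real.enorm_eq_ofReal_abs]
      rw [← ENNReal.ofReal_mul (by positivity), ← ENNReal.ofReal_mul (by positivity),
        ← ENNReal.ofReal_add (by positivity) (by positivity)]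
      refine ENNReal.ofReal_le_ofReal ?_
      have hS : |√(c ^ 2 + R ^ 2) - √(offset R RE x z.2 ^ 2 + R ^ 2)| ≤ δ := by
        refine (abs_sqrt_sub_sqrt_le _ _ _).trans ?_
        rw [abs_sub_comm]; exact hs.le
      by_cases hzd : z ∈ sinogramDomain R RE
      · exact abs_adjoint_integrand_le hδ hm h12 hh₂0 hh₂m (Real.sqrt_nonneg _) (hB z hzd)
          (Real.sqrt_nonneg _) (sqrt_offset_le hRE hR hx _) hS
      -- Outside the sinogram domain `weightBound` is not available, but with u = 0 the weight can
      -- serve as its own bound.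
      · have h := abs_adjoint_integrand_le (u := 0) (v := g (offset R RE x z.2, z.2)) hδ hm h12
          hh₂0 hh₂m (Real.sqrt_nonneg _) le_rfl
          (Real.sqrt_nonneg _) (sqrt_offset_le hRE hR hx _) hS
        rw [hg0 z hzd, hb]
        simpa using h
    · have hs' := not_lt.1 hs
      have h20 : h₂ = 0 := by rw [hh₂, hat_eq_zero hs', zero_div]
      by_cases hz1 : z ∈ A r
      · simp only [K, indicator_of_mem hz1]
        refine le_trans ?_ le_self_add
        rw [Real.enorm_eq_ofReal_abs, ← ENNReal.ofReal_mul (by positivity)]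
        refine ENNReal.ofReal_le_ofReal ?_
        by_cases hzd : z ∈ sinogramDomain R RE
        -- Since h₂ = 0, the values of S₂ and v are immaterial; taking them equal to S₁ and u avoids
        -- comparing weights at distant points and leaves only the kernel error.
        · have h := abs_adjoint_integrand_le (u := g z) (v := g z) (S₁ := √(c ^ 2 + R ^ 2)) (S₂ := √(c ^ 2 + R ^ 2))
            (E := weightBound R RE) hδ hm h12 hh₂0 hh₂m
            (Real.sqrt_nonneg _) (hB z hzd) (Real.sqrt_nonneg _) (hB z hzd) (by simpa using hδ.le)
          rw [h20] at h ⊢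
          rw [ha]
          simpa using h
        · simp [hg0 z hzd, h20]
      · have hz1' : r < |z.1 - offset R RE x z.2| := not_le.1 hz1
        rw [h0 (by linarith), h20]
        simp
  rw [e]
  calc _ ≤ ∫⁻ z, ‖1 / δ ^ 2 * (ψ z * g z - F z)‖ₑ ∂cylinder :=
        enorm_integral_le_lintegral_enorm _
    _ ≤ ∫⁻ z, K z ∂cylinder := by
        rw [cylinder_eq]
        exact setLIntegral_mono hK fun z hz => key z hz.2
    _ = ∫⁻ α in circle, ∫⁻ ξ, K (ξ, α) := lintegral_cylinder hK
    _ = _ := by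
        refine lintegral_congr fun α => ?_
        rw [← lintegral_add_left_eq_self _ (offset R RE x α), majorant,
          ← lintegral_const_mul _ (by fun_prop), ← lintegral_const_mul _ (by fun_prop),
          ← lintegral_indicator measurableSet_Icc, ← lintegral_indicator measurableSet_Icc,
          ← lintegral_add_left (Measurable.indicator (by fun_prop) measurableSet_Icc)]
        refine lintegral_congr fun s => ?_
        simp only [K, A, indicator, mem_ofPred_eq, add_sub_cancel_left, abs_le, mem_Icc]

end Adjoint

/-! ### Independence of representatives -/

section Congr

variable {R RE : ℝ}

/-- For each angle the change of variables makes the preimage of N null for the density |tR|, which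
is positive off t = 0. Tonelli then gives the claim for almost every ray. -/
lemma ae_ae_rayPoint_notMem (hR : R ≠ 0) {N : Set Plane} (hN : MeasurableSet N)
    (h0 : volume N = 0) : ∀ᵐ z ∂cylinder, ∀ᵐ t, rayPoint R RE z t ∉ N := by
  have hS : MeasurableSet {p : (ℝ × ℝ) × ℝ | rayPoint R RE p.1 p.2 ∈ N} :=
    (continuous_rayPoint R RE).measurable hN
  let v : (ℝ × ℝ) × ℝ → ℝ≥0∞ := {p : (ℝ × ℝ) × ℝ | rayPoint R RE p.1 p.2 ∈ N}.indicator 1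
  have hv : Measurable v := measurable_one.indicator hS
  have key (α : ℝ) : ∫⁻ ξ, ∫⁻ t, v ((ξ, α), t) = 0 := by
    have hvα : Measurable fun p : ℝ × ℝ => v ((p.1, α), p.2) := by fun_prop
    have h1 := lintegral_plane_eq hR RE α (h := N.indicator 1) (measurable_one.indicator hN)
    rw [lintegral_indicator_one hN, h0] at h1
    have h2 := (lintegral_eq_zero_iff (by
      change Measurable fun p : ℝ × ℝ => ENNReal.ofReal |p.2 * R| * v ((p.1, α), p.2)
      fun_prop)).1 h1.symm
    have h3 : ∀ᵐ p : ℝ × ℝ, p.2 ≠ 0 := by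
      have h0 : ∀ᵐ t : ℝ, t ≠ 0 := by simp [ae_iff]
      exact Measure.quasiMeasurePreserving_snd.ae h0
    rw [← lintegral_prod (fun p : ℝ × ℝ => v ((p.1, α), p.2)) hvα.aemeasurable,
      ← Measure.volume_eq_prod]
    refine (lintegral_eq_zero_iff hvα).2 ?_
    filter_upwards [h2, h3] with p hp hp2
    have : 0 < |p.2 * R| := abs_pos.2 (mul_ne_zero hp2 hR)
    rcases mul_eq_zero.1 hp with h | h
    · exact absurd (ENNReal.ofReal_eq_zero.1 h) (not_le.2 this)
    · exact h
  have hm : Measurable fun z => ∫⁻ t, v (z, t) := hv.lintegral_prod_right'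
  have h := lintegral_cylinder hm
  simp only [key, lintegral_zero] at h
  filter_upwards [(lintegral_eq_zero_iff hm).1 h] with z hz
  have hvz : Measurable fun t => v (z, t) := by fun_prop
  filter_upwards [(lintegral_eq_zero_iff hvz).1 hz] with t ht hmem
  have : v (z, t) = 1 := indicator_of_mem (by exact hmem) _
  rw [this] at ht
  exact one_ne_zero ht

lemma transform_congr_ae (hR : R ≠ 0) {f f' : Plane → ℝ} (h : f =ᵐ[volume] f') :
    transform R RE f =ᵐ[cylinder] transform R RE f' := by
  obtain ⟨N, hsub, hN, h0⟩ := exists_measurable_superset_of_null (ae_iff.1 h)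
  filter_upwards [ae_ae_rayPoint_notMem (RE := RE) hR hN h0] with z hz
  rw [transform_eq, transform_eq]
  congr 1
  refine integral_congr_ae ?_
  filter_upwards [hz] with t ht
  by_contra hne
  exact ht (hsub hne)

/-- The L² bound for backprojection, applied to the indicator of the exceptional null set, shows
that for almost every x the curve α ↦ (Ξ(x, α), α) meets it only in a null set of angles. -/
lemma transformAdjoint_congr_ae (hRE : 1 < RE) (hR : 0 < R) {g g' : ℝ × ℝ → ℝ}
    (h : g =ᵐ[cylinder] g') :
    transformAdjoint R RE g =ᵐ[volume.restrict imageDomain] transformAdjoint R RE g' := by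
  obtain ⟨N, hsub, hN, h0⟩ := exists_measurable_superset_of_null (ae_iff.1 h)
  have hH : Measurable (N.indicator (1 : ℝ × ℝ → ℝ≥0∞)) := measurable_one.indicator hN
  have hb := lintegral_sq_backprojection_le hRE hR hH
  have e : ∫⁻ z, N.indicator (1 : ℝ × ℝ → ℝ≥0∞) z ^ 2 ∂cylinder = 0 := by
    rw [lintegral_eq_zero_iff (by fun_prop)]
    filter_upwards [measure_eq_zero_iff_ae_notMem.1 h0] with z hz
    simp [hz]
  have ho : Measurable fun p : Plane × ℝ => (offset R RE p.1 p.2, p.2) := by fun_prop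
  have hm : Measurable fun p : Plane × ℝ =>
      N.indicator (1 : ℝ × ℝ → ℝ≥0∞) (offset R RE p.1 p.2, p.2) := hH.comp ho
  rw [e, mul_zero, nonpos_iff_eq_zero, lintegral_eq_zero_iff
    ((Measurable.lintegral_prod_right' hm).pow_const 2)] at hb
  filter_upwards [hb] with x hx
  have hox : Measurable fun α : ℝ => offset R RE x α := by unfold offset depth; fun_prop
  have hx' := (lintegral_eq_zero_iff (hH.comp (hox.prodMk measurable_id))).1
    (pow_eq_zero_iff two_ne_zero |>.1 hx)
  refine integral_congr_ae ?_
  filter_upwards [hx'] with α hα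
  have : g (offset R RE x α, α) = g' (offset R RE x α, α) := by
    by_contra hne
    have hmem : (offset R RE x α, α) ∈ N := hsub hne
    simp [hmem] at hα
  rw [this]

lemma Grid.discreteTransform_congr_ae (D : Grid) {f f' : Plane → ℝ} (h : f =ᵐ[volume] f') :
    D.discreteTransform R RE f = D.discreteTransform R RE f' := by
  have e : D.imageMean f = D.imageMean f' := by
    ext i j
    rw [imageMean, imageMean, integral_congr_ae (ae_restrict_of_ae h)]
  ext z
  simp only [discreteTransform, e]

lemma Grid.discreteTransformAdjoint_congr_ae (D : Grid) {g g' : ℝ × ℝ → ℝ}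
    (h : g =ᵐ[volume] g') :
    D.discreteTransformAdjoint R RE g = D.discreteTransformAdjoint R RE g' := by
  have e : D.sinogramMean R RE g = D.sinogramMean R RE g' := by
    ext p q
    rw [sinogramMean, sinogramMean, integral_congr_ae (ae_restrict_of_ae h)]
  ext x
  simp only [discreteTransformAdjoint, e]

end Congr

/-! ### From step size conditions to the rate δ^ε -/

section Rate

variable {R RE : ℝ}

lemma measurableSet_sinogramDomain : MeasurableSet (sinogramDomain R RE) :=
  measurableSet_Ioo.prod measurableSet_Ico

lemma restrict_sinogramDomain_le : volume.restrict (sinogramDomain R RE) ≤ cylinder := by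
  rw [cylinder_eq]
  exact Measure.restrict_mono (prod_mono (subset_univ _) le_rfl) le_rfl

lemma lintegral_majorant_sq_le_rate {G : ℝ × ℝ → ℝ≥0∞} {h : ℝ × ℝ → ℝ} (hG : Measurable G)
    (hh : Measurable h) {δ ε c C₀ k k' b ρ : ℝ} (hδ : 0 < δ) (hδ1 : δ ≤ 1) (hε : ε ≤ 1)
    (hC₀ : 0 ≤ C₀) (hk : 0 ≤ k) (hk' : 0 ≤ k') (hb : 0 ≤ b) (hρ : 0 ≤ ρ) {Y : ℝ≥0∞}
    (hY : ∫⁻ s in Icc (-δ) δ, modulusSq h s ≤ ENNReal.ofReal (c * δ ^ (1 + 2 * ε)) * Y) :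
    ∫⁻ z, majorant G h (k * (C₀ * δ ^ (1 + ε) / δ ^ 2) + k') (b * (1 / δ)) (ρ * δ) δ z ^ 2 ∂cylinder ≤
      ENNReal.ofReal ((δ ^ ε) ^ 2) * (ENNReal.ofReal (16 * ((k * C₀ + k') * ρ) ^ 2) *
        ∫⁻ z, G z ^ 2 ∂cylinder + ENNReal.ofReal (256 * b ^ 2 * c) * Y) := by
  refine (lintegral_majorant_sq_le hG hh (by positivity) (by positivity) (by positivity)
    hδ.le).trans ((add_le_add le_rfl (mul_le_mul' le_rfl hY)).trans ?_)
  have e1 : δ ^ (1 + ε) = δ * δ ^ ε := by rw [Real.rpow_add hδ, Real.rpow_one]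
  have e2 : δ ^ (1 + 2 * ε) = δ * (δ ^ ε) ^ 2 := by
    rw [Real.rpow_add hδ, Real.rpow_one, mul_comm 2 ε, Real.rpow_mul hδ.le, Real.rpow_two]
  -- Here ε ≤ 1 enters: it absorbs the O(δ) error from the weight.
  have e3 : δ ≤ δ ^ ε := by
    conv_lhs => rw [← Real.rpow_one δ]
    exact Real.rpow_le_rpow_of_exponent_ge hδ hδ1 hε
  have hd0 : 0 < δ ^ ε := by positivity
  rw [e1, e2]
  set d := δ ^ ε
  rw [mul_add, ← mul_assoc (ENNReal.ofReal _) (ENNReal.ofReal _),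
    ← mul_assoc (ENNReal.ofReal _) (ENNReal.ofReal _),
    ← mul_assoc (ENNReal.ofReal _) (ENNReal.ofReal _), ← ENNReal.ofReal_mul (by positivity),
    ← ENNReal.ofReal_mul (by positivity), ← ENNReal.ofReal_mul (by positivity)]
  -- Kernel error η/δ² with η = C₀ δ^(1+ε), times the window radius ρδ, is of order δ^ε.
  have i1 : (k * (C₀ * (δ * d) / δ ^ 2) + k') * (ρ * δ) ≤ (k * C₀ + k') * ρ * d := by
    have : (k * (C₀ * (δ * d) / δ ^ 2) + k') * (ρ * δ) = (k * C₀ * d + k' * δ) * ρ := by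
      field_simp
    rw [this]
    have : k' * δ ≤ k' * d := by gcongr
    nlinarith
  gcongr ?_ * _ + ?_ * _
  · refine ENNReal.ofReal_le_ofReal ?_
    calc _ ≤ 16 * ((k * C₀ + k') * ρ * d) ^ 2 := by gcongr
      _ = _ := by ring
  · refine ENNReal.ofReal_le_ofReal (le_of_eq ?_)
    field_simp

lemma le_ofReal_of_sq_le {e Z : ℝ≥0∞} (hZ : Z ≠ ∞) {d : ℝ} (hd : 0 ≤ d)
    (h : e ^ 2 ≤ ENNReal.ofReal (d ^ 2) * Z) : e ≤ ENNReal.ofReal (√Z.toReal * d) := by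
  have : ENNReal.ofReal (d ^ 2) * Z = ENNReal.ofReal (√Z.toReal * d) ^ 2 := by
    rw [← ENNReal.ofReal_pow (by positivity), mul_pow, Real.sq_sqrt ENNReal.toReal_nonneg,
      mul_comm (Z.toReal), ENNReal.ofReal_mul (by positivity), ENNReal.ofReal_toReal hZ]
  rw [this] at h
  exact (ENNReal.pow_le_pow_left_iff two_ne_zero).1 h

/-- The discretization `D` satisfies the step size conditions with constant `C₀`. -/
structure Grid.IsFine (D : Grid) (R RE ε C₀ : ℝ) : Prop where
  covers : D.Covers
  detectorSize_le : D.detectorSize R RE ≤ 1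
  pixelSize_le : D.pixelSize ≤ C₀ * D.detectorSize R RE ^ (1 + ε)
  angleWidth_le : D.angleWidth ≤ C₀ * D.detectorSize R RE ^ (1 + ε)
  small : 6 * (C₀ * D.detectorSize R RE ^ (1 + ε)) ≤ RE - 1

lemma Grid.IsFine.reach_le {D : Grid} {ε C₀ : ℝ} (h : D.IsFine R RE ε C₀) (hRE : 1 < RE)
    (hR : 0 < R) (hε : 0 < ε) (hC₀ : 0 ≤ C₀) :
    2 * D.detectorSize R RE + offsetLip R RE * (C₀ * D.detectorSize R RE ^ (1 + ε)) ≤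
      (2 + offsetLip R RE * C₀) * D.detectorSize R RE := by
  have hδ := D.detectorSize_pos hRE hR
  have h1 : D.detectorSize R RE ^ (1 + ε) ≤ D.detectorSize R RE := by
    conv_rhs => rw [← Real.rpow_one (D.detectorSize R RE)]
    exact Real.rpow_le_rpow_of_exponent_ge hδ h.detectorSize_le (by linarith)
  have h2 := mul_le_mul_of_nonneg_left h1 (mul_nonneg (offsetLip_nonneg hRE hR) hC₀)
  linarith

lemma eventually_isFine (hRE : 1 < RE) (hR : 0 < R) {ε : ℝ} (hε : 0 < ε) {ι : Type*} {l : Filter ι}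
    {D : ι → Grid} (hcover : ∀ n, (D n).Covers)
    (hδξ : Tendsto (fun n => (D n).detectorSize R RE) l (𝓝 0))
    (hδx : (fun n => (D n).pixelSize) =O[l] fun n => (D n).detectorSize R RE ^ (1 + ε))
    (hδα : (fun n => (D n).angleWidth) =O[l] fun n => (D n).detectorSize R RE ^ (1 + ε)) :
    ∃ C₀, 0 ≤ C₀ ∧ ∀ᶠ n in l, (D n).IsFine R RE ε C₀ := by
  obtain ⟨c₁, hc₁, h1⟩ := hδx.exists_nonneg
  obtain ⟨c₂, hc₂, h2⟩ := hδα.exists_nonneg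
  refine ⟨max c₁ c₂, hc₁.trans (le_max_left _ _), ?_⟩
  have h0 : Tendsto (fun n => 6 * (max c₁ c₂ * (D n).detectorSize R RE ^ (1 + ε))) l (𝓝 0) := by
    have := hδξ.rpow_const (p := 1 + ε) (Or.inr (by linarith))
    rw [Real.zero_rpow (by linarith)] at this
    simpa using (this.const_mul (max c₁ c₂)).const_mul 6
  filter_upwards [h1.bound, h2.bound, h0.eventually_le_const (by linarith : 0 < RE - 1),
    hδξ.eventually_le_const one_pos] with n b1 b2 b3 b4
  have hδ := (D n).detectorSize_pos hRE hR
  have hp : 0 ≤ (D n).detectorSize R RE ^ (1 + ε) := by positivity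
  rw [Real.norm_of_nonneg hp] at b1 b2
  exact ⟨hcover n, b4, ((le_abs_self _).trans b1).trans (by gcongr; exact le_max_left _ _),
    ((le_abs_self _).trans b2).trans (by gcongr; exact le_max_right _ _), b3⟩

end Rate

/-! ### Square integrability and convergence rates -/

section Main

variable {R RE : ℝ}

lemma memLp_two_of_lintegral {X : Type*} [MeasurableSpace X] {μ : Measure X} {u : X → ℝ}
    (hu : AEStronglyMeasurable u μ) (h : ∫⁻ x, ‖u x‖ₑ ^ 2 ∂μ ≠ ∞) : MemLp u 2 μ := by
  refine ⟨hu, ?_⟩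
  rw [← eLpNorm_two_sq] at h
  exact lt_top_iff_ne_top.2 fun h' => h (by simp [h'])

lemma memLp_transform (hRE : 1 < RE) (hR : 0 < R) {f : Plane → ℝ} (hf : Measurable f)
    (hf0 : ∀ x, x ∉ imageDomain → f x = 0) (hf2 : ∫⁻ x, ‖f x‖ₑ ^ 2 ≠ ∞) :
    MemLp (transform R RE f) 2 (volume.restrict (sinogramDomain R RE)) := by
  refine memLp_two_of_lintegral (measurable_transform hf).aestronglyMeasurable ?_
  have hn := measurable_rayNorm (R := R) (RE := RE) hf
  have hw : 0 ≤ detectorWidth R RE / 2 + R := by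
    have := Grid.detectorWidth_pos hRE hR
    positivity
  have key : ∀ z ∈ sinogramDomain R RE, ‖transform R RE f z‖ₑ ^ 2 ≤
      ENNReal.ofReal (detectorWidth R RE / 2 + R) ^ 2 * rayNorm R RE f z ^ 2 := by
    intro z hz
    rw [← mul_pow, transform_eq, enorm_mul, Real.enorm_of_nonneg (Real.sqrt_nonneg _)]
    gcongr
    · exact sqrt_sq_add_sq_le (abs_le.2 ⟨hz.1.1.le, hz.1.2.le⟩) hR.le
    · exact enorm_integral_ray_le z
  refine ne_top_of_le_ne_top ?_ ((setLIntegral_mono (by fun_prop) key).trans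
    ((lintegral_mono' restrict_sinogramDomain_le le_rfl).trans
      ((lintegral_const_mul _ (by fun_prop)).le.trans
        (mul_le_mul' le_rfl (lintegral_rayNorm_sq_cylinder_le hRE hR hf hf0)))))
  exact ENNReal.mul_ne_top (by finiteness) (ENNReal.mul_ne_top (by finiteness) hf2)

lemma memLp_transformAdjoint (hRE : 1 < RE) (hR : 0 < R) {g : ℝ × ℝ → ℝ} (hg : Measurable g)
    (hg2 : ∫⁻ z, ‖g z‖ₑ ^ 2 ∂cylinder ≠ ∞) :
    MemLp (transformAdjoint R RE g) 2 (volume.restrict imageDomain) := by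
  refine memLp_two_of_lintegral (measurable_transformAdjoint hg).aestronglyMeasurable ?_
  let H : ℝ × ℝ → ℝ≥0∞ := fun z => ENNReal.ofReal (offsetWeightBound R RE / (RE - 1)) * ‖g z‖ₑ
  have hH : Measurable H := by fun_prop
  have ho : Measurable fun p : Plane × ℝ => (offset R RE p.1 p.2, p.2) := by fun_prop
  have hm : Measurable fun p : Plane × ℝ => H (offset R RE p.1 p.2, p.2) := hH.comp ho
  have key : ∀ x ∈ imageDomain, ‖transformAdjoint R RE g x‖ₑ ^ 2 ≤
      (∫⁻ α in circle, H (offset R RE x α, α)) ^ 2 := by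
    intro x hx
    refine pow_le_pow_left' ((enorm_integral_le_lintegral_enorm _).trans
      (lintegral_mono fun α => ?_)) 2
    rw [enorm_mul]
    refine mul_le_mul' ?_ le_rfl
    rw [Real.enorm_eq_ofReal_abs]
    exact ENNReal.ofReal_le_ofReal (abs_adjointWeight_le hRE hR hx α)
  refine ne_top_of_le_ne_top ?_ ((setLIntegral_mono
    ((Measurable.lintegral_prod_right' hm).pow_const 2) key).trans
      (lintegral_sq_backprojection_le hRE hR hH))
  simp only [H, mul_pow]
  rw [lintegral_const_mul _ (by fun_prop)]
  exact ENNReal.mul_ne_top (by finiteness) (ENNReal.mul_ne_top (by finiteness) hg2)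

/-- Convergence rate of the discrete transform for Borel measurable functions. -/
lemma exists_rate_transform (hRE : 1 < RE) (hR : 0 < R) {f : Plane → ℝ} (hf : Measurable f)
    (hfi : Integrable f) (hf0 : ∀ x, x ∉ imageDomain → f x = 0) (hf2 : ∫⁻ x, ‖f x‖ₑ ^ 2 ≠ ∞)
    {ε c C₀ : ℝ} (hε : 0 < ε) (hε1 : ε ≤ 1) (hC₀ : 0 ≤ C₀) :
    ∃ C : ℝ, ∀ D : Grid, D.IsFine R RE ε C₀ →
      ∫⁻ t in Icc (-D.detectorSize R RE) (D.detectorSize R RE), modulusSq (transform R RE f) t ≤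
        ENNReal.ofReal (c * D.detectorSize R RE ^ (1 + 2 * ε)) * ∫⁻ x, ‖f x‖ₑ ^ 2 →
      eLpNorm (fun z => D.discreteTransform R RE f z - transform R RE f z) 2
        (volume.restrict (sinogramDomain R RE)) ≤
          ENNReal.ofReal (C * D.detectorSize R RE ^ ε) := by
  have hB0 := weightBound_nonneg hRE hR
  have hK0 := kernelLip_nonneg hRE hR
  have hL0 := offsetLip_nonneg hRE hR
  have hn := measurable_rayNorm (R := R) (RE := RE) hf
  have hT := measurable_transform (R := R) (RE := RE) hf
  have hX : ∫⁻ z, rayNorm R RE f z ^ 2 ∂cylinder ≠ ∞ :=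
    ne_top_of_le_ne_top (ENNReal.mul_ne_top (by finiteness) hf2)
      (lintegral_rayNorm_sq_cylinder_le hRE hR hf hf0)
  have hZ : ENNReal.ofReal (16 * ((weightBound R RE * kernelLip R RE * (RE + 1) * C₀ + 1) *
        (2 + offsetLip R RE * C₀)) ^ 2) * ∫⁻ z, rayNorm R RE f z ^ 2 ∂cylinder +
      ENNReal.ofReal (256 * 1 ^ 2 * c) * ∫⁻ x, ‖f x‖ₑ ^ 2 ≠ ∞ :=
    ENNReal.add_ne_top.2 ⟨ENNReal.mul_ne_top (by finiteness) hX,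
      ENNReal.mul_ne_top (by finiteness) hf2⟩
  -- The constant is the square root of the finite quantity in `hZ`, which does not depend on the
  -- grid.
  refine ⟨_, fun D hD hmod => le_ofReal_of_sq_le hZ
    (Real.rpow_nonneg (D.detectorSize_pos hRE hR).le ε) ?_⟩
  rw [eLpNorm_two_sq]
  refine (setLIntegral_mono ((measurable_majorant hn hT).pow_const 2) fun z hz =>
    pow_le_pow_left' (enorm_discreteTransform_sub_le hRE hR hf hfi hf0 D hD.covers
      hD.detectorSize_le hD.pixelSize_le hD.angleWidth_le hD.small
      (hD.reach_le hRE hR hε hC₀) hz) 2).trans ?_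
  refine (lintegral_mono' restrict_sinogramDomain_le le_rfl).trans ?_
  have h := lintegral_majorant_sq_le_rate hn hT (k := weightBound R RE * kernelLip R RE * (RE + 1))
    (k' := 1) (b := 1) (ρ := 2 + offsetLip R RE * C₀) (D.detectorSize_pos hRE hR)
    hD.detectorSize_le hε1 hC₀ (by positivity) zero_le_one zero_le_one (by positivity) hmod
  rw [one_mul] at h
  exact h

/-- Convergence rate of the discrete adjoint for Borel measurable functions. -/
lemma exists_rate_transformAdjoint (hRE : 1 < RE) (hR : 0 < R) {g : ℝ × ℝ → ℝ} (hg : Measurable g)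
    (hgi : Integrable g) (hg0 : ∀ z, z ∉ sinogramDomain R RE → g z = 0)
    (hg2 : ∫⁻ z, ‖g z‖ₑ ^ 2 ∂cylinder ≠ ∞)
    {ε c C₀ : ℝ} (hε : 0 < ε) (hε1 : ε ≤ 1) (hC₀ : 0 ≤ C₀) :
    ∃ C : ℝ, ∀ D : Grid, D.IsFine R RE ε C₀ →
      ∫⁻ t in Icc (-D.detectorSize R RE) (D.detectorSize R RE), modulusSq g t ≤
        ENNReal.ofReal (c * D.detectorSize R RE ^ (1 + 2 * ε)) * ∫⁻ z, ‖g z‖ₑ ^ 2 ∂cylinder →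
      eLpNorm (fun x => D.discreteTransformAdjoint R RE g x - transformAdjoint R RE g x) 2
        (volume.restrict imageDomain) ≤
          ENNReal.ofReal (C * D.detectorSize R RE ^ ε) := by
  have hm : 0 < RE - 1 := by linarith
  have hB0 := weightBound_nonneg hRE hR
  have hK0 := kernelLip_nonneg hRE hR
  have hL0 := offsetLip_nonneg hRE hR
  have hE0 := offsetWeightBound_nonneg hRE hR
  have ho : Measurable fun p : Plane × ℝ => (offset R RE p.1 p.2, p.2) := by fun_prop
  have hge : Measurable fun z => ‖g z‖ₑ := hg.enorm
  -- The pointwise estimate requires the backprojection integral at x to converge absolutely; the L²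
  -- bound gives this for almost every x.
  have hfin : ∀ᵐ x ∂volume.restrict imageDomain,
      ∫⁻ α in circle, ‖g (offset R RE x α, α)‖ₑ ≠ ∞ := by
    have hmeas : Measurable fun p : Plane × ℝ => ‖g (offset R RE p.1 p.2, p.2)‖ₑ := hge.comp ho
    have hb := lintegral_sq_backprojection_le hRE hR hge
    have hne := ne_top_of_le_ne_top (ENNReal.mul_ne_top (by finiteness) hg2) hb
    filter_upwards [ae_lt_top ((Measurable.lintegral_prod_right' hmeas).pow_const 2) hne] with x hx
    intro h
    simp [h] at hx
  have hZ : ENNReal.ofReal (2 * Real.pi * ((RE + 1) * (2 / R))) * (ENNReal.ofReal (16 *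
        ((weightBound R RE * kernelLip R RE * C₀ + 1 / (RE - 1)) *
          (2 + offsetLip R RE * C₀)) ^ 2) * ∫⁻ z, ‖g z‖ₑ ^ 2 ∂cylinder +
      ENNReal.ofReal (256 * (offsetWeightBound R RE / (RE - 1)) ^ 2 * c) *
        ∫⁻ z, ‖g z‖ₑ ^ 2 ∂cylinder) ≠ ∞ :=
    ENNReal.mul_ne_top (by finiteness) (ENNReal.add_ne_top.2
      ⟨ENNReal.mul_ne_top (by finiteness) hg2, ENNReal.mul_ne_top (by finiteness) hg2⟩)
  refine ⟨_, fun D hD hmod => le_ofReal_of_sq_le hZ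
    (Real.rpow_nonneg (D.detectorSize_pos hRE hR).le ε) ?_⟩
  rw [eLpNorm_two_sq]
  have hpt := (hfin.and (ae_restrict_mem measurableSet_imageDomain)).mono fun x hx =>
    pow_le_pow_left' (enorm_discreteTransformAdjoint_sub_le hRE hR hg hgi hg0 D hD.covers
      hD.detectorSize_le hD.pixelSize_le hD.angleWidth_le hD.small
      (hD.reach_le hRE hR hε hC₀) hx.2 hx.1) 2
  refine (lintegral_mono_ae hpt).trans ((lintegral_sq_backprojection_le hRE hR
    (measurable_majorant hge hg)).trans ?_)
  have h := lintegral_majorant_sq_le_rate hge hg (k := weightBound R RE * kernelLip R RE)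
    (k' := 1 / (RE - 1)) (b := offsetWeightBound R RE / (RE - 1))
    (ρ := 2 + offsetLip R RE * C₀) (D.detectorSize_pos hRE hR)
    hD.detectorSize_le hε1 hC₀ (by positivity) (by positivity) (by positivity)
    (by positivity) hmod
  have e (η δ : ℝ) : weightBound R RE * (kernelLip R RE * η) / δ ^ 2 =
    weightBound R RE * kernelLip R RE * (η / δ ^ 2) := by ring
  rw [e]
  refine (mul_le_mul' le_rfl h).trans_eq ?_
  rw [mul_left_comm]

/-- Provides the Borel representatives, still vanishing off S. The finite measure of S gives
integrability from L². -/
lemma exists_measurable_modification {X : Type*} [MeasurableSpace X] {μ : Measure X} {S : Set X}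
    (hS : MeasurableSet S) (hSfin : μ S ≠ ∞) {f : X → ℝ} (hf : MemLp f 2 (μ.restrict S))
    (hf0 : ∀ x, x ∉ S → f x = 0) :
    ∃ f' : X → ℝ, Measurable f' ∧ f =ᵐ[μ] f' ∧ (∀ x, x ∉ S → f' x = 0) ∧ Integrable f' μ ∧
      ∫⁻ x, ‖f' x‖ₑ ^ 2 ∂μ = eLpNorm f 2 (μ.restrict S) ^ 2 ∧ ∫⁻ x, ‖f' x‖ₑ ^ 2 ∂μ ≠ ∞ := by
  have : IsFiniteMeasure (μ.restrict S) := ⟨by simpa using hSfin.lt_top⟩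
  have hmk : Measurable (hf.1.mk f) := hf.1.stronglyMeasurable_mk.measurable
  have hae : f =ᵐ[μ] S.indicator (hf.1.mk f) := by
    filter_upwards [(ae_restrict_iff' hS).1 hf.1.ae_eq_mk] with x hx
    by_cases h : x ∈ S
    · rw [indicator_of_mem h, hx h]
    · rw [indicator_of_notMem h, hf0 x h]
  have hi : Integrable f μ := by
    have h := hf.integrable (by norm_num)
    have e : S.indicator f = f := indicator_eq_self.2 fun x hx => by
      by_contra hxS
      exact hx (hf0 x hxS)
    rw [← e]
    exact (integrable_indicator_iff hS).2 h
  have hL : ∫⁻ x, ‖S.indicator (hf.1.mk f) x‖ₑ ^ 2 ∂μ = eLpNorm f 2 (μ.restrict S) ^ 2 := by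
    rw [eLpNorm_two_sq, ← lintegral_indicator hS]
    refine lintegral_congr_ae ?_
    filter_upwards [hae] with x hx
    rw [← hx]
    by_cases h : x ∈ S
    · rw [indicator_of_mem h]
    · rw [indicator_of_notMem h, hf0 x h]; simp
  refine ⟨S.indicator (hf.1.mk f), hmk.indicator hS, hae, fun x hx => indicator_of_notMem hx _,
    hi.congr hae, hL, ?_⟩
  rw [hL]
  exact ENNReal.pow_ne_top hf.2.ne

end Main

end Fanbeam

theorem mainTheorem7
    (R RE : ℝ) (hRE : 1 < RE) (hR : RE + 1 < R)
    (f : Fanbeam.Plane → ℝ) (g : ℝ × ℝ → ℝ)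
    -- `f ∈ L²(Ω)` and `g ∈ L²(Ω')`, extended by zero
    (hf : MemLp f 2 (volume.restrict Fanbeam.imageDomain))
    (hf_zero : ∀ x, x ∉ Fanbeam.imageDomain → f x = 0)
    (hg : MemLp g 2 (volume.restrict (Fanbeam.sinogramDomain R RE)))
    (hg_zero : ∀ z, z ∉ Fanbeam.sinogramDomain R RE → g z = 0)
    (ε c : ℝ) (hε : 0 < ε) (hε_le : ε ≤ 1) (hc : 0 ≤ c)
    -- a family of discretizations with `δ_ξ → 0`
    {ι : Type*} (l : Filter ι) (D : ι → Fanbeam.Grid)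
    (hcover : ∀ n, (D n).Covers)
    (hδξ : Tendsto (fun n => (D n).detectorSize R RE) l (𝓝 0))
    (hδx : (fun n => (D n).pixelSize) =O[l] fun n => (D n).detectorSize R RE ^ (1 + ε))
    (hδα : (fun n => (D n).angleWidth) =O[l] fun n => (D n).detectorSize R RE ^ (1 + ε))
    (hf_mod : ∀ᶠ n in l,
      ∫⁻ t in Icc (-(D n).detectorSize R RE) ((D n).detectorSize R RE),
          Fanbeam.modulus (Fanbeam.transform R RE f) t 0 ^ 2
        ≤ ENNReal.ofReal (c * (D n).detectorSize R RE ^ (1 + 2 * ε)) *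
          eLpNorm f 2 (volume.restrict Fanbeam.imageDomain) ^ 2)
    (hg_mod : ∀ᶠ n in l,
      ∫⁻ t in Icc (-(D n).detectorSize R RE) ((D n).detectorSize R RE),
          Fanbeam.modulus g t 0 ^ 2
        ≤ ENNReal.ofReal (c * (D n).detectorSize R RE ^ (1 + 2 * ε)) *
          eLpNorm g 2 (volume.restrict (Fanbeam.sinogramDomain R RE)) ^ 2) :
    (MemLp (Fanbeam.transform R RE f) 2 (volume.restrict (Fanbeam.sinogramDomain R RE)) ∧
      ∃ C : ℝ, ∀ᶠ n in l,
        eLpNorm (fun z => (D n).discreteTransform R RE f z - Fanbeam.transform R RE f z) 2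
            (volume.restrict (Fanbeam.sinogramDomain R RE))
          ≤ ENNReal.ofReal (C * (D n).detectorSize R RE ^ ε)) ∧
    (MemLp (Fanbeam.transformAdjoint R RE g) 2 (volume.restrict Fanbeam.imageDomain) ∧
      ∃ C : ℝ, ∀ᶠ n in l,
        eLpNorm
            (fun x => (D n).discreteTransformAdjoint R RE g x - Fanbeam.transformAdjoint R RE g x) 2
            (volume.restrict Fanbeam.imageDomain)
          ≤ ENNReal.ofReal (C * (D n).detectorSize R RE ^ ε)) := by
  have hR0 : 0 < R := by linarith
  obtain ⟨C₀, hC₀, hfine⟩ := Fanbeam.eventually_isFine hRE hR0 hε hcover hδξ hδx hδα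
  have hS := Fanbeam.measurableSet_sinogramDomain (R := R) (RE := RE)
  constructor
  · obtain ⟨f', hf'm, hff', hf'0, hf'i, hf'n, hf'2⟩ := Fanbeam.exists_measurable_modification
      Fanbeam.measurableSet_imageDomain measure_ball_lt_top.ne hf hf_zero
    -- The equality holds almost everywhere on the whole cylinder and not merely on the sinogram
    -- domain, because the modulus of continuity involves shifts that leave the latter.
    have hT := Fanbeam.transform_congr_ae (RE := RE) hR0.ne' hff'
    have hT' : Fanbeam.transform R RE f =ᵐ[volume.restrict (Fanbeam.sinogramDomain R RE)]
        Fanbeam.transform R RE f' :=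
      (Measure.absolutelyContinuous_of_le Fanbeam.restrict_sinogramDomain_le).ae_le hT
    refine ⟨(Fanbeam.memLp_transform hRE hR0 hf'm hf'0 hf'2).ae_eq hT'.symm, ?_⟩
    obtain ⟨C, hC⟩ := Fanbeam.exists_rate_transform hRE hR0 hf'm hf'i hf'0 hf'2 hε hε_le hC₀
    refine ⟨C, ?_⟩
    filter_upwards [hfine, hf_mod] with n hn hmod
    rw [eLpNorm_congr_ae (g := fun z => (D n).discreteTransform R RE f' z -
      Fanbeam.transform R RE f' z)]
    · refine hC (D n) hn ?_
      simp only [Fanbeam.modulus_sq_eq, Fanbeam.modulusSq_congr hT] at hmod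
      rwa [hf'n]
    · filter_upwards [hT'] with z hz
      rw [hz, (D n).discreteTransform_congr_ae hff']
  · have hfinS : (volume : Measure (ℝ × ℝ)) (Fanbeam.sinogramDomain R RE) ≠ ∞ := by
      rw [Fanbeam.sinogramDomain, Measure.volume_eq_prod, Measure.prod_prod, Fanbeam.volume_circle,
        Real.volume_Ioo]
      finiteness
    obtain ⟨g', hg'm, hgg', hg'0, hg'i, hg'n, hg'2⟩ := Fanbeam.exists_measurable_modification
      hS hfinS hg hg_zero
    have hgc : g =ᵐ[Fanbeam.cylinder] g' := by
      rw [Fanbeam.cylinder_eq]; exact ae_restrict_of_ae hgg'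
    have hcyl : ∫⁻ z, ‖g' z‖ₑ ^ 2 ∂Fanbeam.cylinder = ∫⁻ z, ‖g' z‖ₑ ^ 2 := by
      rw [Fanbeam.cylinder_eq]
      refine setLIntegral_eq_of_support_subset fun z hz => ?_
      by_contra h
      exact hz (by simp [hg'0 z fun h' => h ⟨mem_univ _, h'.2⟩])
    rw [← hcyl] at hg'n hg'2
    have hT := Fanbeam.transformAdjoint_congr_ae hRE hR0 hgc
    refine ⟨(Fanbeam.memLp_transformAdjoint hRE hR0 hg'm hg'2).ae_eq hT.symm, ?_⟩
    obtain ⟨C, hC⟩ := Fanbeam.exists_rate_transformAdjoint hRE hR0 hg'm hg'i hg'0 hg'2 hε hε_le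
      hC₀
    refine ⟨C, ?_⟩
    filter_upwards [hfine, hg_mod] with n hn hmod
    rw [eLpNorm_congr_ae (g := fun x => (D n).discreteTransformAdjoint R RE g' x -
      Fanbeam.transformAdjoint R RE g' x)]
    · refine hC (D n) hn ?_
      simp only [Fanbeam.modulus_sq_eq, Fanbeam.modulusSq_congr hgc] at hmod
      rwa [hg'n]
    · filter_upwards [hT] with x hx
      rw [hx, (D n).discreteTransformAdjoint_congr_ae hgg']
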